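/- Let $d\ge 0$ be an integer, $\alpha>-1/2$, $\mathbb{R}^{d+1}_+=\mathbb{R}^d\times(0,\infty)$, and write $x=(x',x_{d+1})$, $-x:=(-x',x_{d+1})$. Let $$d\mu_\alpha(x)=\frac{x_{d+1}^{2\alpha+1}}{(2\pi)^{d/2}\,2^{\alpha}\,\Gamma(\alpha+1)}\,dx$$ on $\mathbb{R}^{d+1}_+$, let $L^p_\alpha=L^p(\mathbb{R}^{d+1}_+,\mu_\alpha)$ (complex-valued functions) with norm $\|\cdot\|_{\alpha,p}$, and let $d\Theta_\alpha(\sigma,x)=\frac{d\sigma}{\sigma}\,d\mu_\alpha(x)$ on $(0,\infty)\times\mathbb{R}^{d+1}_+$. The Weinstein transform of $f\in L^1_\alpha$ is $$\mathcal F f(\lambda)=\int_{\mathbb{R}^{d+1}_+} f(x)\,\Lambda(\lambda,x)\,d\mu_\alpha(x),\qquad \Lambda(\lambda,x)=e^{-i\langle x',\lambda'\rangle}j_\alpha(x_{d+1}\lambda_{d+1}),\qquad j_\alpha(t)=\Gamma(\alpha+1)\sum_{k\ge0}\frac{(-1)^k(t/2)^{2k}}{k!\,\Gamma(\alpha+k+1)},$$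 and $\mathcal F$ also denotes its continuous extension from $L^1_\alpha\cap L^2_\alpha$ to $L^2_\alpha$. For $f\in L^1_\alpha$ put $\mathcal F^{-1}f(x)=\mathcal F f(-x)$. For $m,\varphi\in L^2_\alpha$ and $\sigma>0$ put $m_\sigma(z)=m(\sigma z)$ and $$\mathcal T_{w,m,\sigma}\varphi(x)=\mathcal F^{-1}\bigl(m_\sigma\,\mathcal F\varphi\bigr)(x)$$ (note that $m_\sigma\mathcal F\varphi\in L^1_\alpha$). Let $m\in L^1_\alpha\cap L^2_\alpha$ be admissible, i.e. $\int_0^\infty|m(\sigma x)|^2\,\frac{d\sigma}{\sigma}=1$ for almost every $x\in\mathbb{R}^{d+1}_+$. Let $\varphi\in L^2_\alpha$, $\varphi\ne0$, let $\Omega\subset\mathbb{R}^{d+1}_+$ and $\Sigma\subset(0,\infty)\times\mathbb{R}^{d+1}_+$ be measurable, and let $\varepsilon,\nu\in\mathbb{R}$. Suppose that $\varphi$ is $\varepsilon$-concentrated on $\Omega$, i.e. $\|\varphi-\chi_\Omega\varphi\|_{\alpha,2}\le\varepsilon\|\varphi\|_{\alpha,2}$, and that $\mathcal T_{w,m,\sigma}\varphi$,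 as a function of $(\sigma,x)$, is $\nu$-concentrated on $\Sigma$, i.e. $\|\mathcal T_{w,m,\sigma}\varphi-\chi_\Sigma\mathcal T_{w,m,\sigma}\varphi\|_{L^2(\Theta_\alpha)}\le\nu\,\|\mathcal T_{w,m,\sigma}\varphi\|_{L^2(\Theta_\alpha)}$. Then $$\|m\|_{\alpha,1}\,\mu_\alpha(\Omega)^{1/2}\left(\iint_\Sigma\frac{d\Theta_\alpha(\sigma,x)}{\sigma^{2(2\alpha+d+2)}}\right)^{1/2}\ \ge\ 1-(\varepsilon+\nu),$$ where the left-hand side is read in $[0,\infty]$ with $0\cdot\infty=0$. -/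

import Mathlib

open MeasureTheory Filter Topology Set
open scoped ENNReal

noncomputable section

namespace Weinstein

/-- Points `x = (x', x_{d+1})`, with `x' ∈ ℝ^d` (Euclidean) and last coordinate `x_{d+1} = x.2`. -/
abbrev Pt (d : ℕ) : Type := EuclideanSpace ℝ (Fin d) × ℝ

/-- The half space `ℝ^d × (0, ∞)`. -/
def halfSpace (d : ℕ) : Set (Pt d) := {x | 0 < x.2}

/-- `(x', x_{d+1}) ↦ (-x', x_{d+1})`. -/
def reflect {d : ℕ} (x : Pt d) : Pt d := (-x.1, x.2)

/-- The weighted measure `x_{d+1}^{2α+1} dx / ((2π)^{d/2} 2^α Γ(α+1))` on the half space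
(extended by zero to the ambient space). The constant is the one for which the Weinstein
transform below is an `L²`-isometry. -/
def mu (d : ℕ) (α : ℝ) : Measure (Pt d) :=
  ((volume : Measure (Pt d)).restrict (halfSpace d)).withDensity fun x =>
    ENNReal.ofReal
      (x.2 ^ (2 * α + 1) / ((2 * Real.pi) ^ ((d : ℝ) / 2) * 2 ^ α * Real.Gamma (α + 1)))

/-- The measure `dσ / σ` on `(0, ∞)`. -/
def dilationMeasure : Measure ℝ :=
  ((volume : Measure ℝ).restrict (Ioi 0)).withDensity fun σ => ENNReal.ofReal (1 / σ)

/-- The measure `(dσ / σ) dμ_α(x)` on `(0, ∞) × (ℝ^d × (0, ∞))`. -/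
def Theta (d : ℕ) (α : ℝ) : Measure (ℝ × Pt d) :=
  dilationMeasure.prod (mu d α)

/-- The normalized Bessel function
`j_α(t) = Γ(α+1) ∑ₖ (-1)^k (t/2)^{2k} / (k! Γ(α+k+1))`. -/
def besselJ (α : ℝ) (t : ℝ) : ℝ :=
  Real.Gamma (α + 1) *
    ∑' k : ℕ, (-1) ^ k * (t / 2) ^ (2 * k) / ((k.factorial : ℝ) * Real.Gamma (α + k + 1))

/-- The Weinstein kernel `Λ(l, x) = exp(-i ⟨x', l'⟩) j_α(x_{d+1} l_{d+1})`. -/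
def kernel {d : ℕ} (α : ℝ) (l x : Pt d) : ℂ :=
  Complex.exp (-(Complex.I * ((inner ℝ x.1 l.1 : ℝ) : ℂ))) * ((besselJ α (x.2 * l.2) : ℝ) : ℂ)

/-- The Weinstein transform given by its integral (for integrable functions). -/
def transform {d : ℕ} (α : ℝ) (f : Pt d → ℂ) (l : Pt d) : ℂ :=
  ∫ x, f x * kernel α l x ∂(mu d α)

/-- The inverse Weinstein transform given by its integral (for integrable functions). -/
def invTransform {d : ℕ} (α : ℝ) (f : Pt d → ℂ) (x : Pt d) : ℂ :=
  transform α f (reflect x)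

/-- `g` is a value at `φ` of the continuous extension to `L²_α` of the Weinstein transform on
`L¹_α ∩ L²_α`: there are `fₙ ∈ L¹_α ∩ L²_α` with `fₙ → φ` and `transform fₙ → g` in `L²_α`. -/
def IsTransformL2 {d : ℕ} (α : ℝ) (φ g : Pt d → ℂ) : Prop :=
  MemLp g 2 (mu d α) ∧
    ∃ f : ℕ → Pt d → ℂ,
      (∀ n, MemLp (f n) 1 (mu d α) ∧ MemLp (f n) 2 (mu d α)) ∧
      Tendsto (fun n => eLpNorm (f n - φ) 2 (mu d α)) atTop (𝓝 0) ∧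
      Tendsto (fun n => eLpNorm (transform α (f n) - g) 2 (mu d α)) atTop (𝓝 0)

open Classical in
/-- The Weinstein transform of `φ ∈ L²_α` (a representative of the class in `L²_α`). -/
def transformL2 {d : ℕ} (α : ℝ) (φ : Pt d → ℂ) : Pt d → ℂ :=
  if h : ∃ g, IsTransformL2 α φ g then h.choose else 0

/-- The multiplier operators `T_{w,m,σ} φ (x) = F⁻¹(m_σ F φ)(x)`, with `m_σ(z) = m(σ z)`, as a
function of `(σ, x)`. For `m, φ ∈ L²_α` and `σ > 0` both `m_σ` and `F φ` are in `L²_α`, so that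
`m_σ F φ` is in `L¹_α` and its inverse transform is given by an absolutely convergent integral
at every `x`; it does not depend on the representatives of `m` and `F φ`. -/
def multiplier {d : ℕ} (α : ℝ) (m φ : Pt d → ℂ) (p : ℝ × Pt d) : ℂ :=
  invTransform α (fun z => m (p.1 • z) * transformL2 α φ z) p.2

/-- The admissibility condition `∫₀^∞ |m(σ x)|² dσ/σ = 1` for almost every `x`. -/
def Admissible {d : ℕ} (α : ℝ) (m : Pt d → ℂ) : Prop :=
  ∀ᵐ x ∂(mu d α), ∫⁻ σ, ‖m (σ • x)‖ₑ ^ 2 ∂dilationMeasure = 1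

/-- `f ∈ L²(ρ)` is `ε`-concentrated on `S`: `‖f - χ_S f‖₂ ≤ ε ‖f‖₂` (both norms are finite). -/
def Concentrated {X : Type*} [MeasurableSpace X] (ρ : Measure X) (ε : ℝ) (S : Set X)
    (f : X → ℂ) : Prop :=
  (eLpNorm (f - S.indicator f) 2 ρ).toReal ≤ ε * (eLpNorm f 2 ρ).toReal

end Weinstein

end

noncomputable section

/-! ### Moments of the Beta distribution. -/

namespace ProbabilityTheory

/-! Write `T` for the multiplier operator and `ψ = χ_Ω φ`. The inequality comes from splitting `Tφ =
(Tφ - χ_S Tφ) + χ_S T(φ - ψ) + χ_S Tψ` and taking `L²(Θ)` norms (`one_le_of_concentrated`). Since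
`T` is an isometry from `L²(μ)` into `L²(Θ)` (`eLpNorm_multiplierAux`), the first two terms are at
most `ν‖φ‖` and `ε‖φ‖`. For the third, `|Fψ| ≤ ‖ψ‖₁ ≤ μ(Ω)^{1/2} ‖φ‖` and `‖m_σ‖₁ = σ^{-(2α+d+2)}
‖m‖₁` bound `Tψ` pointwise (`enorm_multiplierAux_le`), and the square of the bound is integrated
over `S`. Dividing by `‖φ‖` gives the claim when `μ(Ω)` is finite; an infinite `μ(Ω)` only calls for
excluding the convention `0 · ∞ = 0`.

That `T` is an isometry follows from Tonelli, admissibility and Plancherel's theorem for `F`.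
Plancherel (`eLpNorm_transform`) is proved with modulated Gaussians. Poisson's integral shows `|j_α|
≤ 1`, so the kernel is bounded and symmetric and Fubini gives `∫ (Ff) g = ∫ f (Fg)`
(`integral_transform_mul`). The transforms of the Gaussians are explicit, so this formula equates
the Gram matrices of the Gaussians and of their transforms: `F` is isometric on their span. The span
is dense because the Gaussians, with `s = 0` allowed, generate a point-separating star algebra,
which determines finite measures. Pairing with Gaussians finally identifies the extended isometry
with the integral transform on `L¹ ∩ L²`. -/

theorem ae_betaMeasure_mem_Ioo (a b : ℝ) : ∀ᵐ v ∂betaMeasure a b, v ∈ Ioo (0 : ℝ) 1 := by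
  have hm : Measurable (betaPDF a b) := (measurable_betaPDFReal a b).ennreal_ofReal
  rw [betaMeasure, ae_withDensity_iff hm]
  refine Eventually.of_forall fun v hv => ?_
  by_contra h
  apply hv
  rw [betaPDF_eq, if_neg (show ¬(0 < v ∧ v < 1) from h), ENNReal.ofReal_zero]

theorem betaPDFReal_nonneg {a b : ℝ} (ha : 0 < a) (hb : 0 < b) (v : ℝ) :
    0 ≤ betaPDFReal a b v := by
  by_cases h : 0 < v ∧ v < 1
  · exact (betaPDFReal_pos h.1 h.2 ha hb).le
  · simp [betaPDFReal, h]

theorem integral_betaMeasure {a b : ℝ} (ha : 0 < a) (hb : 0 < b) (f : ℝ → ℝ) :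
    ∫ v, f v ∂betaMeasure a b = ∫ v, betaPDFReal a b v * f v := by
  have hm : Measurable (betaPDF a b) := (measurable_betaPDFReal a b).ennreal_ofReal
  rw [betaMeasure, integral_withDensity_eq_integral_toReal_smul hm
    (Eventually.of_forall fun v => ENNReal.ofReal_lt_top)]
  refine integral_congr_ae (Eventually.of_forall fun v => ?_)
  simp [betaPDF, ENNReal.toReal_ofReal (betaPDFReal_nonneg ha hb v)]

/-- Multiplying the Beta density by `v ^ k` gives a multiple of the density with first parameter `a
+ k`, whose total mass is one. -/
theorem integral_pow_betaMeasure {a b : ℝ} (ha : 0 < a) (hb : 0 < b) (k : ℕ) :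
    ∫ v, v ^ k ∂betaMeasure a b = beta (a + k) b / beta a b := by
  have hak : 0 < a + k := by positivity
  have h1 : ∫ v, betaPDFReal (a + k) b v = 1 := by
    have := isProbabilityMeasureBeta hak hb
    simpa using (integral_betaMeasure hak hb fun _ => 1).symm
  have hB := (beta_pos ha hb).ne'
  have hB' := (beta_pos hak hb).ne'
  rw [integral_betaMeasure ha hb, ← mul_one (beta (a + k) b / beta a b), ← h1,
    ← integral_const_mul]
  refine integral_congr_ae (Eventually.of_forall fun v => ?_)
  by_cases h : 0 < v ∧ v < 1
  · simp only [betaPDFReal, if_pos h]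
    rw [add_sub_right_comm, Real.rpow_add h.1, Real.rpow_natCast]
    field_simp
  · simp [betaPDFReal, h]

end ProbabilityTheory

/-! ### Poisson's integral and the bound on the Bessel function. -/

namespace Weinstein

/-- The terms of the power series of the normalized Bessel function. -/
def besselTerm (α t : ℝ) (k : ℕ) : ℝ :=
  (-1) ^ k * (t / 2) ^ (2 * k) / ((k.factorial : ℝ) * Real.Gamma (α + k + 1))

/-- Legendre's duplication formula at `1 / 2 + k`. -/
theorem Gamma_nat_add_half_eq (k : ℕ) :
    Real.Gamma (1 / 2 + k) = (2 * k).factorial * √Real.pi / (4 ^ k * k.factorial) := by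
  have h := Real.Gamma_mul_Gamma_add_half (1 / 2 + k)
  rw [show (1 / 2 + k + 1 / 2 : ℝ) = k + 1 by ring, Real.Gamma_nat_eq_factorial,
    show (2 * (1 / 2 + k) : ℝ) = ((2 * k : ℕ) : ℝ) + 1 by push_cast; ring,
    Real.Gamma_nat_eq_factorial,
    show (1 - (((2 * k : ℕ) : ℝ) + 1)) = -((2 * k : ℕ) : ℝ) by ring,
    Real.rpow_neg two_pos.le, Real.rpow_natCast, pow_mul] at h
  have : (k.factorial : ℝ) ≠ 0 := by positivity
  rw [eq_div_iff (by positivity), mul_comm ((4 : ℝ) ^ k), ← mul_assoc, h]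
  norm_num
  field_simp

/-- The Beta moment is a quotient of Gamma values that converts the Bessel coefficient into the
cosine coefficient `1 / (2k)!`. The second Beta parameter is positive exactly when `α > -1/2`. -/
theorem besselTerm_eq_integral {α : ℝ} (hα : -1 / 2 < α) (t : ℝ) (k : ℕ) :
    Real.Gamma (α + 1) * besselTerm α t k =
      ∫ v, (-1) ^ k * t ^ (2 * k) / ((2 * k).factorial : ℝ) * v ^ k
        ∂ProbabilityTheory.betaMeasure (1 / 2) (α + 1 / 2) := by
  have hb : 0 < α + 1 / 2 := by linarith
  rw [integral_const_mul, ProbabilityTheory.integral_pow_betaMeasure one_half_pos hb,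
    ProbabilityTheory.beta, ProbabilityTheory.beta, Gamma_nat_add_half_eq,
    Real.Gamma_one_half_eq, besselTerm, show (1 / 2 + k + (α + 1 / 2) : ℝ) = α + k + 1 by ring,
    show (1 / 2 + (α + 1 / 2) : ℝ) = α + 1 by ring, div_pow, pow_mul (2 : ℝ)]
  have h1 : 0 < Real.Gamma (α + 1 / 2) := Real.Gamma_pos_of_pos hb
  have h2 : 0 < Real.Gamma (α + 1) := Real.Gamma_pos_of_pos (by linarith)
  have h3 : 0 < Real.Gamma (α + k + 1) :=
    Real.Gamma_pos_of_pos (by have : (0 : ℝ) ≤ k := k.cast_nonneg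
                              linarith)
  have h4 : 0 < √Real.pi := by positivity
  generalize Real.Gamma (α + 1 / 2) = G at h1 ⊢
  norm_num
  field_simp

theorem hasSum_besselTerm {α : ℝ} (hα : -1 / 2 < α) (t : ℝ) :
    HasSum (fun k => Real.Gamma (α + 1) * besselTerm α t k)
      (∫ v, Real.cos (t * √v) ∂ProbabilityTheory.betaMeasure (1 / 2) (α + 1 / 2)) := by
  have hb : 0 < α + 1 / 2 := by linarith
  have := ProbabilityTheory.isProbabilityMeasureBeta one_half_pos hb
  have hmem := ProbabilityTheory.ae_betaMeasure_mem_Ioo (1 / 2) (α + 1 / 2)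
  have hint (k : ℕ) : Integrable (fun v : ℝ => (-1) ^ k * t ^ (2 * k) /
      ((2 * k).factorial : ℝ) * v ^ k) (ProbabilityTheory.betaMeasure (1 / 2) (α + 1 / 2)) := by
    refine Integrable.const_mul ?_ _
    refine (integrable_const (1 : ℝ)).mono' (by fun_prop) ?_
    filter_upwards [hmem] with v hv
    rw [Real.norm_eq_abs, abs_pow, abs_of_pos hv.1]
    exact pow_le_one₀ hv.1.le hv.2.le
  have hsum : Summable fun k : ℕ => ∫ v, ‖(-1) ^ k * t ^ (2 * k) /
      ((2 * k).factorial : ℝ) * v ^ k‖ ∂ProbabilityTheory.betaMeasure (1 / 2) (α + 1 / 2) := by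
    -- Since `0 < v < 1` almost everywhere, the series of `cosh t` dominates and sum and integral
    -- may be exchanged.
    refine Summable.of_nonneg_of_le (fun k => integral_nonneg fun v => norm_nonneg _)
      (fun k => ?_) (Real.hasSum_cosh t).summable
    calc _ ≤ ∫ v, t ^ (2 * k) / ((2 * k).factorial : ℝ)
          ∂ProbabilityTheory.betaMeasure (1 / 2) (α + 1 / 2) := by
          refine integral_mono_ae (hint k).norm (integrable_const _) ?_
          filter_upwards [hmem] with v hv
          rw [norm_mul, norm_div, norm_mul, norm_pow, norm_neg, norm_one, one_pow, one_mul,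
            Real.norm_eq_abs (v ^ k), abs_pow, abs_of_pos hv.1, Real.norm_natCast,
            Real.norm_eq_abs, pow_mul, abs_of_nonneg (by positivity : (0 : ℝ) ≤ (t ^ 2) ^ k)]
          exact mul_le_of_le_one_right (by positivity) (pow_le_one₀ hv.1.le hv.2.le)
      _ = _ := by rw [integral_const, probReal_univ, one_smul]
  have h := hasSum_integral_of_summable_integral_norm hint hsum
  simp_rw [← besselTerm_eq_integral hα] at h
  refine (congrArg (HasSum _) ?_).mpr h
  refine integral_congr_ae ?_
  filter_upwards [hmem] with v hv
  rw [Real.cos_eq_tsum]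
  refine tsum_congr fun k => ?_
  rw [mul_pow, pow_mul (√v), Real.sq_sqrt hv.1.le]
  ring

theorem besselJ_eq_tsum (α t : ℝ) :
    besselJ α t = Real.Gamma (α + 1) * ∑' k, besselTerm α t k := rfl

theorem summable_besselTerm {α : ℝ} (hα : -1 / 2 < α) (t : ℝ) : Summable (besselTerm α t) :=
  (summable_mul_left_iff (Real.Gamma_pos_of_pos (by linarith)).ne').1 (hasSum_besselTerm hα t).summable

/-- Poisson's integral representation of the normalized Bessel function. -/
theorem besselJ_eq_integral {α : ℝ} (hα : -1 / 2 < α) (t : ℝ) :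
    besselJ α t =
      ∫ v, Real.cos (t * √v) ∂ProbabilityTheory.betaMeasure (1 / 2) (α + 1 / 2) := by
  rw [besselJ_eq_tsum, ← tsum_mul_left, (hasSum_besselTerm hα t).tsum_eq]

theorem abs_besselJ_le {α : ℝ} (hα : -1 / 2 < α) (t : ℝ) : |besselJ α t| ≤ 1 := by
  have := ProbabilityTheory.isProbabilityMeasureBeta one_half_pos (by linarith : 0 < α + 1 / 2)
  rw [besselJ_eq_integral hα, ← Real.norm_eq_abs]
  refine (norm_integral_le_of_norm_le_const
    (Eventually.of_forall fun v => Real.abs_cos_le_one _)).trans ?_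
  rw [probReal_univ, one_mul]

theorem measurable_besselJ {α : ℝ} (hα : -1 / 2 < α) : Measurable (besselJ α) := by
  have h : ∀ t, Tendsto (fun n => ∑ k ∈ Finset.range n, besselTerm α t k) atTop
      (𝓝 (∑' k, besselTerm α t k)) := fun t => (summable_besselTerm hα t).hasSum.tendsto_sum_nat
  have : Measurable fun t => ∑' k, besselTerm α t k := by
    refine measurable_of_tendsto_metrizable (f := fun n t => ∑ k ∈ Finset.range n, besselTerm α t k)
      (fun n => ?_) (tendsto_pi_nhds.2 h)
    unfold besselTerm
    fun_prop
  exact this.const_mul _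

/-! ### The weighted measure as a product, and the Hankel transform of a Gaussian. -/

/-- The radial factor of the weighted measure, on `(0, ∞)`. -/
def hankelMeasure (α : ℝ) : Measure ℝ :=
  ((volume : Measure ℝ).restrict (Ioi 0)).withDensity fun t =>
    ENNReal.ofReal (t ^ (2 * α + 1) / (2 ^ α * Real.Gamma (α + 1)))

instance (α : ℝ) : SFinite (hankelMeasure α) := by
  unfold hankelMeasure; infer_instance

/-- The Euclidean factor of the weighted measure. -/
def euclideanMeasure (d : ℕ) : Measure (EuclideanSpace ℝ (Fin d)) :=
  ENNReal.ofReal ((2 * Real.pi) ^ ((d : ℝ) / 2))⁻¹ • volume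

instance (d : ℕ) : SFinite (euclideanMeasure d) := by
  unfold euclideanMeasure; infer_instance

/-- The constant is shared out so that in each factor the standard Gaussian is its own transform. -/
theorem mu_eq_prod (d : ℕ) (α : ℝ) : mu d α = (euclideanMeasure d).prod (hankelMeasure α) := by
  have hm : Measurable fun t : ℝ =>
    ENNReal.ofReal (t ^ (2 * α + 1) / (2 ^ α * Real.Gamma (α + 1))) := by fun_prop
  have hset : halfSpace d = univ ×ˢ Ioi (0 : ℝ) := by ext; simp [halfSpace]
  rw [euclideanMeasure, hankelMeasure, Measure.prod_smul_left, prod_withDensity_right hm,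
    ← withDensity_smul _ (by fun_prop), mu, hset, Measure.volume_eq_prod, ← Measure.prod_restrict,
    Measure.restrict_univ]
  congr 1
  ext x
  rw [Pi.smul_apply, smul_eq_mul, ← ENNReal.ofReal_mul (by positivity)]
  congr 1
  rw [inv_mul_eq_div, div_div, mul_assoc, mul_comm ((2 * Real.pi) ^ ((d : ℝ) / 2)), mul_assoc]

instance (d : ℕ) (α : ℝ) : SFinite (mu d α) := by
  rw [mu_eq_prod]; infer_instance

theorem integral_euclideanMeasure {d : ℕ} (f : EuclideanSpace ℝ (Fin d) → ℂ) :
    ∫ x, f x ∂euclideanMeasure d = ((2 * Real.pi) ^ ((d : ℝ) / 2) : ℝ)⁻¹ • ∫ x, f x := by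
  rw [euclideanMeasure, integral_smul_measure, ENNReal.toReal_ofReal (by positivity)]

theorem integral_hankelMeasure {α : ℝ} (hα : -1 < α) (f : ℝ → ℝ) :
    ∫ t, f t ∂hankelMeasure α =
      (∫ t in Ioi 0, t ^ (2 * α + 1) * f t) / (2 ^ α * Real.Gamma (α + 1)) := by
  have hG := Real.Gamma_pos_of_pos (by linarith : 0 < α + 1)
  rw [hankelMeasure, integral_withDensity_eq_integral_toReal_smul (by fun_prop)
    (Eventually.of_forall fun t => ENNReal.ofReal_lt_top), ← integral_div]
  refine setIntegral_congr_fun measurableSet_Ioi fun t (ht : 0 < t) => ?_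
  simp only [smul_eq_mul]
  rw [ENNReal.toReal_ofReal (by positivity)]
  ring

theorem integral_pow_mul_exp_hankelMeasure {α s : ℝ} (hα : -1 < α) (hs : 0 < s) (k : ℕ) :
    ∫ t, t ^ (2 * k) * Real.exp (-(s / 2) * t ^ 2) ∂hankelMeasure α =
      2 ^ k * Real.Gamma (α + k + 1) / Real.Gamma (α + 1) * (s ^ (-(α + 1)) / s ^ k) := by
  have hG := Real.Gamma_pos_of_pos (by linarith : 0 < α + 1)
  have hk : (0 : ℝ) ≤ k := k.cast_nonneg
  have h := integral_rpow_mul_exp_neg_mul_rpow (p := 2) (q := 2 * α + 1 + (2 * k : ℕ)) (b := s / 2)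
    two_pos (by push_cast; linarith) (by positivity)
  rw [integral_hankelMeasure hα]
  have h' : ∫ t in Ioi (0 : ℝ), t ^ (2 * α + 1) * (t ^ (2 * k) * Real.exp (-(s / 2) * t ^ 2)) =
      ∫ t in Ioi (0 : ℝ), t ^ (2 * α + 1 + (2 * k : ℕ)) * Real.exp (-(s / 2) * t ^ (2 : ℝ)) := by
    refine setIntegral_congr_fun measurableSet_Ioi fun t (ht : 0 < t) => ?_
    rw [Real.rpow_add ht (2 * α + 1), Real.rpow_natCast, Real.rpow_two, mul_assoc]
  rw [h', h, show ((2 * α + 1 + (2 * k : ℕ) + 1) / 2 : ℝ) = α + k + 1 by push_cast; ring,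
    show (-(2 * α + 1 + (2 * k : ℕ) + 1) / 2 : ℝ) = -(α + 1) + -(k : ℝ) by push_cast; ring,
    Real.div_rpow hs.le two_pos.le, Real.rpow_add hs, Real.rpow_add two_pos,
    Real.rpow_neg hs.le (k : ℝ), Real.rpow_neg two_pos.le (k : ℝ), Real.rpow_neg two_pos.le (α + 1),
    Real.rpow_add two_pos, Real.rpow_one, Real.rpow_natCast, Real.rpow_natCast]
  have : (0 : ℝ) < 2 ^ α := by positivity
  field_simp

theorem integrable_pow_mul_exp_hankelMeasure {α s : ℝ} (hα : -1 < α) (hs : 0 < s) (k : ℕ) :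
    Integrable (fun t : ℝ => t ^ (2 * k) * Real.exp (-(s / 2) * t ^ 2)) (hankelMeasure α) := by
  have hG := Real.Gamma_pos_of_pos (by linarith : 0 < α + 1)
  have hG' := Real.Gamma_pos_of_pos (by have : (0 : ℝ) ≤ k := k.cast_nonneg
                                        linarith : 0 < α + k + 1)
  -- A non-integrable function would have Bochner integral zero, but the value already computed is
  -- positive.
  by_contra h
  have h0 := integral_undef h
  rw [integral_pow_mul_exp_hankelMeasure hα hs] at h0
  exact absurd h0 (by positivity)

/-- Gaussians are eigenfunctions of the Hankel transform, up to a dilation. -/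
theorem integral_exp_mul_besselJ {α s : ℝ} (hα : -1 / 2 < α) (hs : 0 < s) (l : ℝ) :
    ∫ t, Real.exp (-(s / 2) * t ^ 2) * besselJ α (t * l) ∂hankelMeasure α =
      s ^ (-(α + 1)) * Real.exp (-(l ^ 2 / (2 * s))) := by
  have hα' : -1 < α := by linarith
  have hG := Real.Gamma_pos_of_pos (by linarith : 0 < α + 1)
  have hG' (k : ℕ) : 0 < Real.Gamma (α + k + 1) :=
    Real.Gamma_pos_of_pos (by have : (0 : ℝ) ≤ k := k.cast_nonneg
                              linarith)
  -- Absolute values of the coefficients of `t ^ (2 * k)` in `j_α (t l)`. Integrated term by term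
  -- against the Gaussian, they give the exponential series at `l² / (2s)`; with signs restored, the
  -- one at `-l² / (2s)`.
  set c : ℕ → ℝ := fun k => Real.Gamma (α + 1) * (l / 2) ^ (2 * k) /
    ((k.factorial : ℝ) * Real.Gamma (α + k + 1)) with hc
  have hc0 (k : ℕ) : 0 ≤ c k := by
    have := hG' k
    have : 0 ≤ (l / 2) ^ (2 * k) := by rw [pow_mul]; positivity
    positivity
  have hci (k : ℕ) : c k * ∫ t, t ^ (2 * k) * Real.exp (-(s / 2) * t ^ 2) ∂hankelMeasure α =
      s ^ (-(α + 1)) * ((l ^ 2 / (2 * s)) ^ k / k.factorial) := by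
    have := hG' k
    rw [integral_pow_mul_exp_hankelMeasure hα' hs, hc]
    simp only [pow_mul, div_pow, mul_pow]
    rw [show (2 ^ 2 : ℝ) = 2 * 2 by norm_num, mul_pow]
    field_simp
  have hint (k : ℕ) : Integrable (fun t : ℝ => (-1) ^ k * c k *
      (t ^ (2 * k) * Real.exp (-(s / 2) * t ^ 2))) (hankelMeasure α) :=
    (integrable_pow_mul_exp_hankelMeasure hα' hs k).const_mul _
  have hnorm (k : ℕ) : ∫ t, ‖(-1) ^ k * c k * (t ^ (2 * k) * Real.exp (-(s / 2) * t ^ 2))‖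
      ∂hankelMeasure α = s ^ (-(α + 1)) * ((l ^ 2 / (2 * s)) ^ k / k.factorial) := by
    rw [← hci, ← integral_const_mul]
    refine integral_congr_ae (Eventually.of_forall fun t => ?_)
    have : 0 ≤ t ^ (2 * k) := by rw [pow_mul]; positivity
    simp only [norm_mul, norm_pow, norm_neg, norm_one, one_pow, one_mul]
    rw [Real.norm_of_nonneg (hc0 k), ← norm_pow, Real.norm_of_nonneg this,
      Real.norm_of_nonneg (Real.exp_pos _).le]
  have hsum := hasSum_integral_of_summable_integral_norm hint (by
    simp_rw [hnorm]
    exact (Real.summable_pow_div_factorial _).mul_left _)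
  have h1 : HasSum (fun k => ∫ t, (-1) ^ k * c k * (t ^ (2 * k) * Real.exp (-(s / 2) * t ^ 2))
      ∂hankelMeasure α) (s ^ (-(α + 1)) * Real.exp (-(l ^ 2 / (2 * s)))) := by
    have := ((NormedSpace.expSeries_div_hasSum_exp (-(l ^ 2 / (2 * s)))).mul_left (s ^ (-(α + 1))))
    rw [← Real.exp_eq_exp_ℝ] at this
    refine this.congr_fun fun k => ?_
    rw [integral_const_mul, mul_assoc, hci, neg_pow (l ^ 2 / (2 * s))]
    generalize l ^ 2 / (2 * s) = x
    ring
  rw [← hsum.unique h1]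
  refine integral_congr_ae (Eventually.of_forall fun t => ?_)
  simp only [besselJ_eq_tsum, besselTerm, hc]
  rw [← tsum_mul_left, ← tsum_mul_left]
  refine tsum_congr fun k => ?_
  rw [div_pow, mul_pow, div_pow]
  ring

end Weinstein

theorem MeasureTheory.Integrable.memLp_two_of_bound {X : Type*} [MeasurableSpace X]
    {ρ : Measure X} {f : X → ℂ} (hf : Integrable f ρ) {C : ℝ} (hC : ∀ x, ‖f x‖ ≤ C) :
    MemLp f 2 ρ := by
  rw [memLp_two_iff_integrable_sq_norm hf.1]
  refine (hf.norm.const_mul C).mono' (hf.1.norm.pow 2) (Eventually.of_forall fun x => ?_)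
  rw [norm_pow, norm_norm, sq]
  exact mul_le_mul_of_nonneg_right (hC x) (norm_nonneg _)

/-! ### The kernel and the multiplication formula. -/

namespace Weinstein

variable {d : ℕ} {α : ℝ}

theorem norm_kernel_le (hα : -1 / 2 < α) (l x : Pt d) : ‖kernel α l x‖ ≤ 1 := by
  rw [kernel, norm_mul, ← mul_neg, ← Complex.ofReal_neg, mul_comm Complex.I,
    Complex.norm_exp_ofReal_mul_I, one_mul, Complex.norm_real]
  exact abs_besselJ_le hα _

theorem kernel_comm (l x : Pt d) : kernel α l x = kernel α x l := by
  rw [kernel, kernel, real_inner_comm, mul_comm x.2]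

theorem measurable_kernel (hα : -1 / 2 < α) :
    Measurable fun p : Pt d × Pt d => kernel α p.1 p.2 := by
  have := measurable_besselJ hα
  unfold kernel
  fun_prop

theorem integrable_mul_kernel (hα : -1 / 2 < α) {f : Pt d → ℂ} (hf : Integrable f (mu d α))
    (l : Pt d) : Integrable (fun x => f x * kernel α l x) (mu d α) := by
  refine hf.mul_bdd (c := 1) ?_ (Eventually.of_forall fun x => norm_kernel_le hα l x)
  exact ((measurable_kernel hα).comp measurable_prodMk_left).aestronglyMeasurable

theorem norm_transform_le (hα : -1 / 2 < α) (f : Pt d → ℂ) (l : Pt d) :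
    ‖transform α f l‖ₑ ≤ eLpNorm f 1 (mu d α) := by
  rw [eLpNorm_one_eq_lintegral_enorm]
  refine (enorm_integral_le_lintegral_enorm _).trans (lintegral_mono fun x => ?_)
  rw [enorm_mul]
  refine mul_le_of_le_one_right' ?_
  rw [← ofReal_norm]
  exact ENNReal.ofReal_le_one.2 (norm_kernel_le hα l x)

theorem stronglyMeasurable_transform (hα : -1 / 2 < α) {f : Pt d → ℂ}
    (hf : AEStronglyMeasurable f (mu d α)) : StronglyMeasurable (transform α f) := by
  have h : transform α f = transform α (hf.mk f) := by
    ext l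
    refine integral_congr_ae ?_
    filter_upwards [hf.ae_eq_mk] with x hx
    rw [hx]
  rw [h]
  have : StronglyMeasurable fun p : Pt d × Pt d => hf.mk f p.2 * kernel α p.1 p.2 :=
    (hf.stronglyMeasurable_mk.comp_measurable measurable_snd).mul
      (measurable_kernel hα).stronglyMeasurable
  exact this.integral_prod_right

theorem transform_sub (hα : -1 / 2 < α) {f g : Pt d → ℂ} (hf : Integrable f (mu d α))
    (hg : Integrable g (mu d α)) : transform α (f - g) = transform α f - transform α g := by
  ext l
  simp only [transform, Pi.sub_apply, sub_mul]
  exact integral_sub (integrable_mul_kernel hα hf l) (integrable_mul_kernel hα hg l)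

/-- Fubini, applicable because the kernel is bounded, together with the symmetry of the kernel. -/
theorem integral_transform_mul (hα : -1 / 2 < α) {f g : Pt d → ℂ}
    (hf : Integrable f (mu d α)) (hg : Integrable g (mu d α)) :
    ∫ l, transform α f l * g l ∂mu d α = ∫ x, f x * transform α g x ∂mu d α := by
  have hint : Integrable (fun p : Pt d × Pt d => f p.2 * kernel α p.1 p.2 * g p.1)
      ((mu d α).prod (mu d α)) := by
    have h := (hg.mul_prod hf).mul_bdd (c := 1)
      (measurable_kernel hα).aestronglyMeasurable
      (Eventually.of_forall fun p => norm_kernel_le hα p.1 p.2)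
    refine h.congr (Eventually.of_forall fun p => ?_)
    simp only
    ring
  simp only [transform, ← integral_mul_const, ← integral_const_mul]
  rw [integral_integral_swap hint]
  refine integral_congr_ae (Eventually.of_forall fun x => ?_)
  refine integral_congr_ae (Eventually.of_forall fun l => ?_)
  simp only [kernel_comm l x]
  ring

/-! ### Gaussians and their transforms. -/

/-- The modulated Gaussian `exp(-s |x|² / 2 + i ⟨y, x'⟩)`. -/
def gaussian (s : ℝ) (y : EuclideanSpace ℝ (Fin d)) (x : Pt d) : ℂ :=
  Complex.exp (-((s / 2 : ℝ) : ℂ) * (‖x.1‖ : ℂ) ^ 2 + Complex.I * ((inner ℝ y x.1 : ℝ) : ℂ)) *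
    ((Real.exp (-(s / 2) * x.2 ^ 2) : ℝ) : ℂ)

/-- The translated Gaussian, which is the transform of `gaussian s y`. -/
def bump (α s : ℝ) (y : EuclideanSpace ℝ (Fin d)) (x : Pt d) : ℂ :=
  (((s ^ (-((d : ℝ) / 2 + (α + 1)))) : ℝ) : ℂ) * gaussian s⁻¹ 0 (x.1 - y, x.2)

theorem transform_mul_eq (f : EuclideanSpace ℝ (Fin d) → ℂ) (g : ℝ → ℝ) (l : Pt d) :
    transform α (fun x => f x.1 * (g x.2 : ℂ)) l =
      ((2 * Real.pi) ^ ((d : ℝ) / 2) : ℝ)⁻¹ •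
        (∫ v, f v * Complex.exp (-(Complex.I * ((inner ℝ v l.1 : ℝ) : ℂ)))) *
      ((∫ t, g t * besselJ α (t * l.2) ∂hankelMeasure α : ℝ) : ℂ) := by
  rw [← integral_euclideanMeasure, ← integral_complex_ofReal, ← integral_prod_mul, ← mu_eq_prod,
    transform]
  refine integral_congr_ae (Eventually.of_forall fun x => ?_)
  simp only [kernel, Complex.ofReal_mul]
  ring

theorem integral_gaussian_mul_exp {s : ℝ} (hs : 0 < s) (y w : EuclideanSpace ℝ (Fin d)) :
    ((2 * Real.pi) ^ ((d : ℝ) / 2) : ℝ)⁻¹ •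
      (∫ v : EuclideanSpace ℝ (Fin d),
        Complex.exp (-((s / 2 : ℝ) : ℂ) * (‖v‖ : ℂ) ^ 2 + Complex.I * ((inner ℝ y v : ℝ) : ℂ)) *
          Complex.exp (-(Complex.I * ((inner ℝ v w : ℝ) : ℂ)))) =
      ((s ^ (-((d : ℝ) / 2)) * Real.exp (-(‖w - y‖ ^ 2 / (2 * s))) : ℝ) : ℂ) := by
  have h := GaussianFourier.integral_cexp_neg_mul_sq_norm_add (b := ((s / 2 : ℝ) : ℂ))
    (by rw [Complex.ofReal_re]; positivity) Complex.I (y - w)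
  have h' : ∀ v : EuclideanSpace ℝ (Fin d),
      Complex.exp (-((s / 2 : ℝ) : ℂ) * (‖v‖ : ℂ) ^ 2 + Complex.I * ((inner ℝ y v : ℝ) : ℂ)) *
          Complex.exp (-(Complex.I * ((inner ℝ v w : ℝ) : ℂ))) =
        Complex.exp (-((s / 2 : ℝ) : ℂ) * (‖v‖ : ℂ) ^ 2 +
          Complex.I * ((inner ℝ (y - w) v : ℝ) : ℂ)) := fun v => by
    rw [← Complex.exp_add, inner_sub_left, real_inner_comm v w]
    congr 1
    push_cast
    ring
  simp_rw [h', h]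
  have h2 : (((Real.pi : ℝ) : ℂ) / ((s / 2 : ℝ) : ℂ)) ^ ((Module.finrank ℝ
      (EuclideanSpace ℝ (Fin d)) : ℂ) / 2) =
      (((2 * Real.pi) ^ ((d : ℝ) / 2) * s ^ (-((d : ℝ) / 2)) : ℝ) : ℂ) := by
    rw [finrank_euclideanSpace_fin, Real.rpow_neg hs.le, ← div_eq_mul_inv,
      ← Real.div_rpow (by positivity) hs.le, Complex.ofReal_cpow (by positivity)]
    push_cast
    congr 1
    field_simp
  have h3 : Complex.exp (Complex.I ^ 2 * (‖y - w‖ : ℂ) ^ 2 / (4 * ((s / 2 : ℝ) : ℂ))) =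
      ((Real.exp (-(‖w - y‖ ^ 2 / (2 * s))) : ℝ) : ℂ) := by
    rw [norm_sub_rev, Complex.I_sq]
    push_cast
    congr 1
    field_simp
    norm_num
  rw [h2, h3, Complex.real_smul, ← Complex.ofReal_mul, ← Complex.ofReal_mul]
  congr 1
  have : 0 < (2 * Real.pi) ^ ((d : ℝ) / 2) := by positivity
  field_simp

theorem transform_gaussian (hα : -1 / 2 < α) {s : ℝ} (hs : 0 < s)
    (y : EuclideanSpace ℝ (Fin d)) : transform α (gaussian s y) = bump α s y := by
  ext l
  have h := transform_mul_eq (α := α) (fun v : EuclideanSpace ℝ (Fin d) =>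
    Complex.exp (-((s / 2 : ℝ) : ℂ) * (‖v‖ : ℂ) ^ 2 + Complex.I * ((inner ℝ y v : ℝ) : ℂ)))
    (fun t => Real.exp (-(s / 2) * t ^ 2)) l
  rw [integral_gaussian_mul_exp hs, integral_exp_mul_besselJ hα hs] at h
  refine h.trans ?_
  have hN : s ^ (-((d : ℝ) / 2 + (α + 1))) = s ^ (-((d : ℝ) / 2)) * s ^ (-(α + 1)) := by
    rw [← Real.rpow_add hs]
    congr 1
    ring
  rw [bump, gaussian, hN, inner_zero_left]
  push_cast
  rw [mul_zero, add_zero, mul_mul_mul_comm]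
  congr 2
  all_goals
    congr 1
    field_simp

theorem transform_bump (hα : -1 / 2 < α) {s : ℝ} (hs : 0 < s)
    (y : EuclideanSpace ℝ (Fin d)) : transform α (bump α s y) = gaussian s (-y) := by
  ext l
  have hs' := inv_pos.2 hs
  have h := transform_mul_eq (α := α) (fun v : EuclideanSpace ℝ (Fin d) =>
    (((s ^ (-((d : ℝ) / 2 + (α + 1)))) : ℝ) : ℂ) *
    Complex.exp (-((s⁻¹ / 2 : ℝ) : ℂ) * (‖v - y‖ : ℂ) ^ 2 +
      Complex.I * ((inner ℝ (0 : EuclideanSpace ℝ (Fin d)) (v - y) : ℝ) : ℂ)))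
    (fun t => Real.exp (-(s⁻¹ / 2) * t ^ 2)) l
  have h1 : transform α (bump α s y) l = _ := Eq.trans (by
    unfold bump gaussian
    simp only [mul_assoc]) h
  -- Translating by `y` centres the Gaussian; the kernel contributes the phase `exp(-i ⟨y, l'⟩)`,
  -- hence the modulation `-y`.
  rw [h1, integral_exp_mul_besselJ hα hs', ← integral_add_right_eq_self _ y]
  generalize hN : s ^ (-((d : ℝ) / 2 + (α + 1))) = N
  generalize hM : s⁻¹ ^ (-(α + 1)) = M
  simp only [add_sub_cancel_right, inner_add_left, Complex.ofReal_add, mul_add, neg_add,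
    Complex.exp_add (-(Complex.I * _)), mul_assoc]
  simp only [← mul_assoc, integral_mul_const]
  simp only [mul_assoc, integral_const_mul]
  have h2 := integral_gaussian_mul_exp hs' (0 : EuclideanSpace ℝ (Fin d)) l.1
  rw [Complex.real_smul] at h2 ⊢
  have e1 : ∀ a b c e f : ℂ, a * (b * (c * e)) * f = (b * e) * (a * c) * f := fun _ _ _ _ _ => by
    ring
  rw [e1, h2, gaussian, inner_neg_left]
  have h3 : N * s⁻¹ ^ (-((d : ℝ) / 2)) * M = 1 := by
    rw [← hN, ← hM, Real.inv_rpow hs.le, Real.inv_rpow hs.le, neg_add, Real.rpow_add hs]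
    have : 0 < s ^ (-((d : ℝ) / 2)) := by positivity
    have : 0 < s ^ (-(α + 1)) := by positivity
    field_simp
  rw [Complex.exp_add]
  have h4 : Complex.exp (-((s / 2 : ℝ) : ℂ) * (‖l.1‖ : ℂ) ^ 2) =
      ((Real.exp (-(‖l.1 - 0‖ ^ 2 / (2 * s⁻¹))) : ℝ) : ℂ) := by
    rw [sub_zero]
    push_cast
    congr 1
    field_simp
  have h5 : Real.exp (-(s / 2) * l.2 ^ 2) = Real.exp (-(l.2 ^ 2 / (2 * s⁻¹))) := by
    congr 1
    field_simp
  rw [h4, h5, Complex.ofReal_neg, mul_neg]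
  have h6 := congrArg (fun r : ℝ => (r : ℂ)) h3
  simp only [Complex.ofReal_mul, Complex.ofReal_one] at h6 ⊢
  linear_combination (((Real.exp (-(‖l.1 - 0‖ ^ 2 / (2 * s⁻¹))) : ℝ) : ℂ) *
    Complex.exp (-(Complex.I * ((inner ℝ y l.1 : ℝ) : ℂ))) *
    ((Real.exp (-(l.2 ^ 2 / (2 * s⁻¹))) : ℝ) : ℂ)) * h6

theorem conj_gaussian (s : ℝ) (y : EuclideanSpace ℝ (Fin d)) (x : Pt d) :
    (starRingEnd ℂ) (gaussian s y x) = gaussian s (-y) x := by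
  rw [gaussian, gaussian, map_mul, Complex.conj_ofReal, ← Complex.exp_conj, inner_neg_left]
  simp [Complex.conj_ofNat]

theorem conj_bump (s : ℝ) (y : EuclideanSpace ℝ (Fin d)) (x : Pt d) :
    (starRingEnd ℂ) (bump α s y x) = bump α s y x := by
  rw [bump, map_mul, Complex.conj_ofReal, conj_gaussian, neg_zero]

theorem norm_gaussian (s : ℝ) (y : EuclideanSpace ℝ (Fin d)) (x : Pt d) :
    ‖gaussian s y x‖ = Real.exp (-(s / 2) * ‖x.1‖ ^ 2 + -(s / 2) * x.2 ^ 2) := by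
  rw [gaussian, norm_mul, Complex.norm_exp, Complex.norm_real,
    Real.norm_of_nonneg (Real.exp_pos _).le, Real.exp_add]
  congr 2
  rw [← Complex.ofReal_neg, ← Complex.ofReal_pow, ← Complex.ofReal_mul, Complex.add_re,
    Complex.ofReal_re, Complex.I_mul_re, Complex.ofReal_im, neg_zero, add_zero]

theorem norm_gaussian_le {s : ℝ} (hs : 0 ≤ s) (y : EuclideanSpace ℝ (Fin d)) (x : Pt d) :
    ‖gaussian s y x‖ ≤ 1 := by
  rw [norm_gaussian]
  refine Real.exp_le_one_iff.2 ?_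
  nlinarith [mul_nonneg hs (sq_nonneg ‖x.1‖), mul_nonneg hs (sq_nonneg x.2)]

theorem gaussian_mul (s r : ℝ) (y z : EuclideanSpace ℝ (Fin d)) (x : Pt d) :
    gaussian s y x * gaussian r z x = gaussian (s + r) (y + z) x := by
  simp only [gaussian, inner_add_left, Complex.ofReal_exp]
  simp only [← Complex.exp_add]
  congr 1
  push_cast
  ring

theorem continuous_gaussian (s : ℝ) (y : EuclideanSpace ℝ (Fin d)) :
    Continuous (gaussian s y) := by
  unfold gaussian
  fun_prop

theorem integrable_gaussian (hα : -1 / 2 < α) {s : ℝ} (hs : 0 < s)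
    (y : EuclideanSpace ℝ (Fin d)) : Integrable (gaussian s y) (mu d α) := by
  rw [mu_eq_prod]
  refine Integrable.mul_prod (f := fun v => Complex.exp (-((s / 2 : ℝ) : ℂ) * (‖v‖ : ℂ) ^ 2 +
    Complex.I * ((inner ℝ y v : ℝ) : ℂ))) (g := fun t => ((Real.exp (-(s / 2) * t ^ 2) : ℝ) : ℂ))
    ?_ ?_
  · exact (GaussianFourier.integrable_cexp_neg_mul_sq_norm_add
      (by rw [Complex.ofReal_re]; positivity) _ _).smul_measure ENNReal.ofReal_ne_top
  · have := integrable_pow_mul_exp_hankelMeasure (by linarith : -1 < α) hs 0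
    simpa using this.ofReal (𝕜 := ℂ)

theorem integrable_bump (hα : -1 / 2 < α) {s : ℝ} (hs : 0 < s)
    (y : EuclideanSpace ℝ (Fin d)) : Integrable (bump α s y) (mu d α) := by
  refine Integrable.const_mul ?_ _
  rw [mu_eq_prod]
  refine Integrable.mul_prod (f := fun v => Complex.exp (-((s⁻¹ / 2 : ℝ) : ℂ) *
    (‖v - y‖ : ℂ) ^ 2 + Complex.I * ((inner ℝ (0 : EuclideanSpace ℝ (Fin d)) (v - y) : ℝ) : ℂ)))
    (g := fun t => ((Real.exp (-(s⁻¹ / 2) * t ^ 2) : ℝ) : ℂ)) ?_ ?_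
  · refine Integrable.smul_measure ?_ ENNReal.ofReal_ne_top
    exact (GaussianFourier.integrable_cexp_neg_mul_sq_norm_add (b := ((s⁻¹ / 2 : ℝ) : ℂ))
      (by rw [Complex.ofReal_re]; positivity) Complex.I
      (0 : EuclideanSpace ℝ (Fin d))).comp_sub_right y
  · have := integrable_pow_mul_exp_hankelMeasure (by linarith : -1 < α) (inv_pos.2 hs) 0
    simpa using this.ofReal (𝕜 := ℂ)

theorem memLp_gaussian (hα : -1 / 2 < α) {s : ℝ} (hs : 0 < s)
    (y : EuclideanSpace ℝ (Fin d)) : MemLp (gaussian s y) 2 (mu d α) :=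
  (integrable_gaussian hα hs y).memLp_two_of_bound (norm_gaussian_le hs.le y)

theorem memLp_bump (hα : -1 / 2 < α) {s : ℝ} (hs : 0 < s)
    (y : EuclideanSpace ℝ (Fin d)) : MemLp (bump α s y) 2 (mu d α) := by
  refine (integrable_bump hα hs y).memLp_two_of_bound
    (C := ‖(((s ^ (-((d : ℝ) / 2 + (α + 1)))) : ℝ) : ℂ)‖) fun x => ?_
  rw [bump, norm_mul]
  exact mul_le_of_le_one_right (norm_nonneg _) (norm_gaussian_le (inv_pos.2 hs).le _ _)

/-- The multiplication formula moves the transform from the first factor to the second, which is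
real and transforms back to the conjugate Gaussian. This is the equality of Gram matrices behind
Plancherel. -/
theorem integral_bump_mul_conj_bump (hα : -1 / 2 < α) {s r : ℝ} (hs : 0 < s) (hr : 0 < r)
    (y z : EuclideanSpace ℝ (Fin d)) :
    ∫ l, bump α s y l * (starRingEnd ℂ) (bump α r z l) ∂mu d α =
      ∫ x, gaussian s y x * (starRingEnd ℂ) (gaussian r z x) ∂mu d α := by
  simp_rw [conj_bump, conj_gaussian]
  rw [← transform_gaussian hα hs y, integral_transform_mul hα (integrable_gaussian hα hs y)
    (integrable_bump hα hr z), transform_bump hα hr]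

/-! ### Completeness of the Gaussians. -/

open scoped BoundedContinuousFunction NNReal ComplexConjugate

theorem measurableSet_halfSpace (d : ℕ) : MeasurableSet (halfSpace d) :=
  measurableSet_lt measurable_const measurable_snd

theorem ae_mem_halfSpace (d : ℕ) (α : ℝ) : ∀ᵐ x ∂mu d α, x ∈ halfSpace d :=
  (withDensity_absolutelyContinuous _ _).ae_le (ae_restrict_mem (measurableSet_halfSpace d))

/-- The Gaussians as bounded continuous functions on the closed half space. -/
def gaussianBCF (p : ℝ≥0 × EuclideanSpace ℝ (Fin d)) :
    (EuclideanSpace ℝ (Fin d) × ℝ≥0) →ᵇ ℂ :=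
  BoundedContinuousFunction.ofNormedAddCommGroup
    (fun x => gaussian (p.1 : ℝ) p.2 (x.1, (x.2 : ℝ)))
    ((continuous_gaussian _ _).comp (by fun_prop)) 1 fun x => norm_gaussian_le p.1.2 p.2 _

theorem gaussianBCF_apply (p : ℝ≥0 × EuclideanSpace ℝ (Fin d))
    (x : EuclideanSpace ℝ (Fin d) × ℝ≥0) :
    gaussianBCF p x = gaussian (p.1 : ℝ) p.2 (x.1, (x.2 : ℝ)) := rfl

theorem gaussianBCF_mul (p q : ℝ≥0 × EuclideanSpace ℝ (Fin d)) :
    gaussianBCF p * gaussianBCF q = gaussianBCF (p + q) := by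
  ext x
  simp only [BoundedContinuousFunction.mul_apply, gaussianBCF_apply, gaussian_mul, Prod.fst_add,
    Prod.snd_add, NNReal.coe_add]

/-- Allowing `s = 0` supplies the unit of the algebra. -/
theorem gaussianBCF_zero : gaussianBCF (0 : ℝ≥0 × EuclideanSpace ℝ (Fin d)) = 1 := by
  ext x
  simp [gaussianBCF_apply, gaussian]

theorem star_gaussianBCF (p : ℝ≥0 × EuclideanSpace ℝ (Fin d)) :
    star (gaussianBCF p) = gaussianBCF (p.1, -p.2) := by
  ext x
  rw [BoundedContinuousFunction.star_apply, gaussianBCF_apply, gaussianBCF_apply]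
  exact conj_gaussian _ _ _

/-- The algebra spanned by the Gaussians. -/
def gaussianAlgebra (d : ℕ) :
    StarSubalgebra ℂ ((EuclideanSpace ℝ (Fin d) × ℝ≥0) →ᵇ ℂ) where
  toSubalgebra := (Submodule.span ℂ (range (gaussianBCF (d := d)))).toSubalgebra
    (Submodule.subset_span ⟨0, gaussianBCF_zero⟩) (by
      intro f g hf hg
      refine Submodule.span_induction₂ (p := fun f g _ _ =>
        f * g ∈ Submodule.span ℂ (range (gaussianBCF (d := d)))) ?_ ?_ ?_ ?_ ?_ ?_ ?_ hf hg
      · rintro _ _ ⟨p, rfl⟩ ⟨q, rfl⟩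
        exact Submodule.subset_span ⟨p + q, (gaussianBCF_mul p q).symm⟩
      · intro y _
        simp
      · intro y _
        simp
      · intro x y z _ _ _ h1 h2
        rw [add_mul]
        exact add_mem h1 h2
      · intro x y z _ _ _ h1 h2
        rw [mul_add]
        exact add_mem h1 h2
      · intro r x y _ _ h
        rw [smul_mul_assoc]
        exact Submodule.smul_mem _ r h
      · intro r x y _ _ h
        rw [mul_smul_comm]
        exact Submodule.smul_mem _ r h)
  star_mem' := by
    intro f hf
    refine Submodule.span_induction (p := fun f _ =>
      star f ∈ Submodule.span ℂ (range (gaussianBCF (d := d)))) ?_ ?_ ?_ ?_ hf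
    · rintro _ ⟨p, rfl⟩
      exact Submodule.subset_span ⟨_, (star_gaussianBCF p).symm⟩
    · simp
    · intro x y _ _ h1 h2
      rw [star_add]
      exact add_mem h1 h2
    · intro r x _ h
      rw [star_smul]
      exact Submodule.smul_mem _ _ h

theorem mem_gaussianAlgebra {f : (EuclideanSpace ℝ (Fin d) × ℝ≥0) →ᵇ ℂ} :
    f ∈ gaussianAlgebra d ↔ f ∈ Submodule.span ℂ (range (gaussianBCF (d := d))) := Iff.rfl

theorem exists_exp_inner_ne {E : Type*} [NormedAddCommGroup E] [InnerProductSpace ℝ E] {x z : E}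
    (h : x ≠ z) : ∃ y : E, Complex.exp (Complex.I * ((inner ℝ y x : ℝ) : ℂ)) ≠
      Complex.exp (Complex.I * ((inner ℝ y z : ℝ) : ℂ)) := by
  have hn : ‖x - z‖ ^ 2 ≠ 0 := by simpa [sub_eq_zero] using h
  -- Scaled so that its inner product with `x - z` is `1`; equal exponentials would then force `exp
  -- I = 1`, impossible as `2π > 1`.
  refine ⟨(‖x - z‖ ^ 2)⁻¹ • (x - z), fun he => ?_⟩
  have h1 : Complex.exp (Complex.I) = 1 := by
    have h2 : Complex.exp (Complex.I *
        ((inner ℝ ((‖x - z‖ ^ 2)⁻¹ • (x - z)) (x - z) : ℝ) : ℂ)) = 1 := by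
      rw [inner_sub_right, Complex.ofReal_sub, mul_sub, Complex.exp_sub, he,
        div_self (Complex.exp_ne_zero _)]
    rwa [real_inner_smul_left, real_inner_self_eq_norm_sq, inv_mul_cancel₀ hn, Complex.ofReal_one,
      mul_one] at h2
  obtain ⟨n, hn⟩ := Complex.exp_eq_one_iff.1 h1
  have h3 := congrArg Complex.im hn
  simp at h3
  have hpi := Real.pi_gt_three
  rcases lt_trichotomy n 0 with h0 | h0 | h0
  · have : (n : ℝ) ≤ -1 := by exact_mod_cast Int.le_sub_one_of_lt h0
    nlinarith
  · simp [h0] at h3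
  · have : (1 : ℝ) ≤ n := by exact_mod_cast h0
    nlinarith

/-- Pure phases (`s = 0`) separate the Euclidean coordinates. The Gaussian with `s = 1` sees only
the square of the last coordinate, which suffices because that coordinate is nonnegative. -/
theorem separatesPoints_gaussianAlgebra (d : ℕ) :
    ((gaussianAlgebra d).map
      (BoundedContinuousFunction.toContinuousMapStarₐ ℂ)).SeparatesPoints := by
  intro x z hxz
  suffices h : ∃ p : ℝ≥0 × EuclideanSpace ℝ (Fin d), gaussianBCF p x ≠ gaussianBCF p z by
    obtain ⟨p, hp⟩ := h
    refine ⟨_, ⟨BoundedContinuousFunction.toContinuousMapStarₐ ℂ (gaussianBCF p),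
      ⟨gaussianBCF p, Submodule.subset_span ⟨p, rfl⟩, rfl⟩, rfl⟩, hp⟩
  by_cases h1 : x.1 = z.1
  · refine ⟨(1, 0), fun h => ?_⟩
    have h2 : x.2 ≠ z.2 := fun h2 => hxz (Prod.ext h1 h2)
    rw [gaussianBCF_apply, gaussianBCF_apply, gaussian, gaussian] at h
    simp only [h1] at h
    have h3 := mul_left_cancel₀ (Complex.exp_ne_zero _) h
    have h4 := Real.exp_injective (Complex.ofReal_injective h3)
    have h5 : (x.2 : ℝ) ^ 2 = (z.2 : ℝ) ^ 2 := by
      rw [NNReal.coe_one] at h4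
      linarith
    exact h2 (NNReal.coe_injective ((sq_eq_sq₀ x.2.2 z.2.2).1 h5))
  · obtain ⟨y, hy⟩ := exists_exp_inner_ne h1
    exact ⟨(0, y), by simpa [gaussianBCF_apply, gaussian] using hy⟩

/-- The positive and negative parts of `r` are densities of two finite measures. Pushed to the
closed half space, a Polish space, these agree on a point-separating star algebra and so coincide.
-/
theorem ae_eq_zero_of_integral_ofReal_mul_gaussian {r : Pt d → ℝ} (hr : Integrable r (mu d α))
    (h : ∀ s : ℝ, 0 ≤ s → ∀ y, ∫ x, (r x : ℂ) * gaussian s y x ∂mu d α = 0) :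
    r =ᵐ[mu d α] 0 := by
  let q : Pt d → EuclideanSpace ℝ (Fin d) × ℝ≥0 := fun x => (x.1, x.2.toNNReal)
  have hq : Measurable q := by fun_prop
  let j : EuclideanSpace ℝ (Fin d) × ℝ≥0 → Pt d := fun x => (x.1, (x.2 : ℝ))
  have hj : Measurable j := by fun_prop
  -- No information is lost by the pushforward, since the measure lives on the half space.
  have hjq : ∀ᵐ x ∂mu d α, j (q x) = x := by
    filter_upwards [ae_mem_halfSpace d α] with x hx
    exact Prod.ext rfl (Real.coe_toNNReal _ (le_of_lt hx))
  let ρ : (Pt d → ℝ) → Measure (Pt d) := fun u =>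
    (mu d α).withDensity fun x => ENNReal.ofReal (u x)
  have hmap (u : Pt d → ℝ) : ((ρ u).map q).map j = ρ u := by
    rw [Measure.map_map hj hq]
    have : (j ∘ q) =ᵐ[ρ u] id := (withDensity_absolutelyContinuous _ _).ae_le hjq
    rw [Measure.map_congr this, Measure.map_id]
  have hfin (u : Pt d → ℝ) (hu : Integrable u (mu d α)) : IsFiniteMeasure (ρ u) :=
    isFiniteMeasure_withDensity_ofReal hu.2
  have hint (u : Pt d → ℝ) (hu : Integrable u (mu d α)) (p) :
      ∫ z, gaussianBCF p z ∂(ρ u).map q =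
        ∫ x, ((max (u x) 0 : ℝ) : ℂ) * gaussian p.1 p.2 x ∂mu d α := by
    rw [integral_map hq.aemeasurable (gaussianBCF p).continuous.aestronglyMeasurable,
      integral_withDensity_eq_integral_toReal_smul₀ hu.1.aemeasurable.ennreal_ofReal
        (Eventually.of_forall fun x => ENNReal.ofReal_lt_top)]
    refine integral_congr_ae ?_
    filter_upwards [hjq] with x hx
    rw [ENNReal.toReal_ofReal', Complex.real_smul, gaussianBCF_apply]
    congr 2
  have := hfin r hr
  have := hfin (-r) hr.neg
  have hP : (ρ r).map q = (ρ (-r)).map q := by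
    have := Measure.isFiniteMeasure_map (ρ r) q
    have := Measure.isFiniteMeasure_map (ρ (-r)) q
    refine ext_of_forall_mem_subalgebra_integral_eq_of_polish
      (separatesPoints_gaussianAlgebra d) fun g hg => ?_
    refine Submodule.span_induction (p := fun g _ => ∫ z, g z ∂(ρ r).map q =
      ∫ z, g z ∂(ρ (-r)).map q) ?_ ?_ ?_ ?_ (mem_gaussianAlgebra.1 hg)
    · rintro _ ⟨p, rfl⟩
      have hgi (u : Pt d → ℝ) (hu : Integrable u (mu d α)) :
          Integrable (fun x => ((max (u x) 0 : ℝ) : ℂ) * gaussian p.1 p.2 x) (mu d α) :=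
        (hu.pos_part.ofReal (𝕜 := ℂ)).mul_bdd (c := 1)
          (continuous_gaussian _ _).aestronglyMeasurable
          (Eventually.of_forall fun x => norm_gaussian_le p.1.2 p.2 x)
      rw [hint r hr, hint (-r) hr.neg, ← sub_eq_zero,
        ← integral_sub (hgi r hr) (hgi (-r) hr.neg), ← h p.1 p.1.2 p.2]
      refine integral_congr_ae (Eventually.of_forall fun x => ?_)
      simp only [← sub_mul, ← Complex.ofReal_sub, Pi.neg_apply]
      congr 2
      rcases le_total 0 (r x) with h0 | h0
      · rw [max_eq_left h0, max_eq_right (neg_nonpos.2 h0), sub_zero]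
      · rw [max_eq_right h0, max_eq_left (neg_nonneg.2 h0), zero_sub, neg_neg]
    · simp
    · intro f g _ _ hf hg
      simp only [BoundedContinuousFunction.add_apply]
      rw [integral_add (f.integrable _) (g.integrable _),
        integral_add (f.integrable _) (g.integrable _), hf, hg]
    · intro c f _ hf
      simp only [BoundedContinuousFunction.smul_apply]
      rw [integral_smul, integral_smul, hf]
  have hρ : ρ r = ρ (-r) := by rw [← hmap r, hP, hmap]
  have hlt : ∫⁻ x, ENNReal.ofReal (r x) ∂mu d α ≠ ⊤ := by
    have h1 := measure_ne_top (ρ r) univ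
    rwa [withDensity_apply _ MeasurableSet.univ, Measure.restrict_univ] at h1
  have h2 := (withDensity_eq_iff hr.1.aemeasurable.ennreal_ofReal
    hr.neg.1.aemeasurable.ennreal_ofReal hlt).1 hρ
  filter_upwards [h2] with x hx
  have h3 := congrArg ENNReal.toReal hx
  rw [ENNReal.toReal_ofReal', ENNReal.toReal_ofReal', Pi.neg_apply] at h3
  rcases le_total 0 (r x) with h0 | h0
  · rwa [max_eq_left h0, max_eq_right (neg_nonpos.2 h0)] at h3
  · rw [max_eq_right h0, max_eq_left (neg_nonneg.2 h0)] at h3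
    exact neg_eq_zero.1 h3.symm

/-- A function is determined by its integrals against the Gaussians. -/
theorem ae_eq_zero_of_integral_mul_gaussian {k : Pt d → ℂ}
    (hk : Integrable (fun x => k x * gaussian 1 0 x) (mu d α))
    (h : ∀ s : ℝ, 0 < s → ∀ y, ∫ x, k x * gaussian s y x ∂mu d α = 0) :
    k =ᵐ[mu d α] 0 := by
  -- A fixed Gaussian factor makes `k` integrable, and the parameter shift `1 + s` brings the value
  -- `s = 0` within the hypothesis.
  set f : Pt d → ℂ := fun x => k x * gaussian 1 0 x with hf
  have h1 (s : ℝ) (hs : 0 ≤ s) (y) : ∫ x, f x * gaussian s y x ∂mu d α = 0 := by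
    rw [← h (1 + s) (by positivity) y]
    refine integral_congr_ae (Eventually.of_forall fun x => ?_)
    simp only [hf]
    rw [mul_assoc, gaussian_mul, zero_add]
  have h2 (s : ℝ) (hs : 0 ≤ s) (y) : ∫ x, conj (f x) * gaussian s y x ∂mu d α = 0 := by
    rw [← map_zero conj, ← h1 s hs (-y), ← integral_conj]
    refine integral_congr_ae (Eventually.of_forall fun x => ?_)
    simp only [map_mul, conj_gaussian, neg_neg]
  have hi (s : ℝ) (hs : 0 ≤ s) (y) : Integrable (fun x => f x * gaussian s y x) (mu d α) :=
    hk.mul_bdd (c := 1) (continuous_gaussian _ _).aestronglyMeasurable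
      (Eventually.of_forall fun x => norm_gaussian_le hs y x)
  have hkc : Integrable (fun x => conj (f x)) (mu d α) := by
    refine hk.congr' (Complex.continuous_conj.comp_aestronglyMeasurable hk.1)
      (Eventually.of_forall fun x => ?_)
    exact (RCLike.norm_conj _).symm
  have hic (s : ℝ) (hs : 0 ≤ s) (y) :
      Integrable (fun x => conj (f x) * gaussian s y x) (mu d α) :=
    hkc.mul_bdd (c := 1) (continuous_gaussian _ _).aestronglyMeasurable
      (Eventually.of_forall fun x => norm_gaussian_le hs y x)
  have hre : (fun x => (f x).re) =ᵐ[mu d α] 0 := by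
    refine ae_eq_zero_of_integral_ofReal_mul_gaussian hk.re fun s hs y => ?_
    have h3 : ∫ x, (f x * gaussian s y x + conj (f x) * gaussian s y x) / 2 ∂mu d α = 0 := by
      rw [integral_div, integral_add (hi s hs y) (hic s hs y), h1 s hs, h2 s hs]
      simp
    rw [← h3]
    refine integral_congr_ae (Eventually.of_forall fun x => ?_)
    simp only [Complex.re_eq_add_conj]
    ring
  have him : (fun x => (f x).im) =ᵐ[mu d α] 0 := by
    refine ae_eq_zero_of_integral_ofReal_mul_gaussian hk.im fun s hs y => ?_
    have h3 : ∫ x, (f x * gaussian s y x - conj (f x) * gaussian s y x) / (2 * Complex.I)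
        ∂mu d α = 0 := by
      rw [integral_div, integral_sub (hi s hs y) (hic s hs y), h1 s hs, h2 s hs]
      simp
    rw [← h3]
    refine integral_congr_ae (Eventually.of_forall fun x => ?_)
    simp only [Complex.im_eq_sub_conj]
    ring
  filter_upwards [hre, him] with x hx hx'
  have h4 : k x * gaussian 1 0 x = 0 := Complex.ext hx hx'
  refine (mul_eq_zero.1 h4).resolve_right (norm_ne_zero_iff.1 ?_)
  rw [norm_gaussian]
  exact (Real.exp_pos _).ne'

end Weinstein

/-! ### Plancherel's theorem and the extension to `L²`. -/

namespace MeasureTheory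

theorem tendsto_eLpNorm_sub_of_tendsto {X : Type*} [MeasurableSpace X] {ρ : Measure X}
    {F : ℕ → X → ℂ} {G H : X → ℂ} (hF : ∀ n, MemLp (F n) 2 ρ) (hG : MemLp G 2 ρ)
    (hH : MemLp H 2 ρ) (h : Tendsto (fun n => eLpNorm (F n - G) 2 ρ) atTop (𝓝 0)) :
    Tendsto (fun n => eLpNorm (F n - H) 2 ρ) atTop (𝓝 (eLpNorm (G - H) 2 ρ)) := by
  have h1 := (Lp.tendsto_Lp_iff_tendsto_eLpNorm'' F hF G hG).2 h
  have h2 := (h1.sub_const (hH.toLp H)).enorm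
  simpa only [← MemLp.toLp_sub, Lp.enorm_toLp] using h2

end MeasureTheory

namespace Weinstein

open scoped ComplexConjugate

variable {d : ℕ} {α : ℝ}

/-- The index set of the Gaussians. -/
abbrev GaussianIndex (d : ℕ) : Type := Ioi (0 : ℝ) × EuclideanSpace ℝ (Fin d)

/-- The Gaussians as elements of `L²`. -/
def gaussianLp (hα : -1 / 2 < α) (i : GaussianIndex d) : Lp ℂ 2 (mu d α) :=
  (memLp_gaussian hα i.1.2 i.2).toLp _

/-- The transforms of the Gaussians as elements of `L²`. -/
def bumpLp (hα : -1 / 2 < α) (i : GaussianIndex d) : Lp ℂ 2 (mu d α) :=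
  (memLp_bump hα i.1.2 i.2).toLp _

theorem inner_gaussianLp (hα : -1 / 2 < α) (i : GaussianIndex d) (u : Lp ℂ 2 (mu d α)) :
    inner ℂ (gaussianLp hα i) u = ∫ x, u x * gaussian i.1 (-i.2) x ∂mu d α := by
  rw [L2.inner_def]
  refine integral_congr_ae ?_
  filter_upwards [(memLp_gaussian hα i.1.2 i.2).coeFn_toLp] with x hx
  rw [gaussianLp, hx, RCLike.inner_apply, conj_gaussian]

theorem inner_bumpLp (hα : -1 / 2 < α) (i : GaussianIndex d) (u : Lp ℂ 2 (mu d α)) :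
    inner ℂ (bumpLp hα i) u = ∫ x, u x * bump α i.1 i.2 x ∂mu d α := by
  rw [L2.inner_def]
  refine integral_congr_ae ?_
  filter_upwards [(memLp_bump hα i.1.2 i.2).coeFn_toLp] with x hx
  rw [bumpLp, hx, RCLike.inner_apply, conj_bump]

theorem inner_bumpLp_bumpLp (hα : -1 / 2 < α) (i j : GaussianIndex d) :
    inner ℂ (bumpLp hα i) (bumpLp hα j) = inner ℂ (gaussianLp hα i) (gaussianLp hα j) := by
  rw [L2.inner_def, L2.inner_def]
  have h := integral_bump_mul_conj_bump hα j.1.2 i.1.2 j.2 i.2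
  refine Eq.trans ?_ (h.trans ?_)
  · refine integral_congr_ae ?_
    filter_upwards [(memLp_bump hα i.1.2 i.2).coeFn_toLp,
      (memLp_bump hα j.1.2 j.2).coeFn_toLp] with x hx hx'
    rw [bumpLp, bumpLp, hx, hx', RCLike.inner_apply]
  · refine integral_congr_ae ?_
    filter_upwards [(memLp_gaussian hα i.1.2 i.2).coeFn_toLp,
      (memLp_gaussian hα j.1.2 j.2).coeFn_toLp] with x hx hx'
    rw [gaussianLp, gaussianLp, hx, hx', RCLike.inner_apply]

/-- The squared norm of a combination depends only on the Gram matrix. -/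
theorem norm_linearCombination_eq {I E : Type*} [NormedAddCommGroup E] [InnerProductSpace ℂ E]
    {a b : I → E} (h : ∀ i j, inner ℂ (a i) (a j) = inner ℂ (b i) (b j)) (l : I →₀ ℂ) :
    ‖Finsupp.linearCombination ℂ a l‖ = ‖Finsupp.linearCombination ℂ b l‖ := by
  have h1 : inner ℂ (Finsupp.linearCombination ℂ a l) (Finsupp.linearCombination ℂ a l) =
      inner ℂ (Finsupp.linearCombination ℂ b l) (Finsupp.linearCombination ℂ b l) := by
    simp only [Finsupp.linearCombination_apply, Finsupp.sum, sum_inner, inner_sum,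
      inner_smul_left, inner_smul_right, h]
  rw [inner_self_eq_norm_sq_to_K, inner_self_eq_norm_sq_to_K] at h1
  have h2 : ‖Finsupp.linearCombination ℂ a l‖ ^ 2 = ‖Finsupp.linearCombination ℂ b l‖ ^ 2 := by
    exact_mod_cast h1
  exact (sq_eq_sq₀ (norm_nonneg _) (norm_nonneg _)).1 h2

theorem integrable_mul_gaussian (hα : -1 / 2 < α) {u : Pt d → ℂ} (hu : MemLp u 2 (mu d α))
    {s : ℝ} (hs : 0 < s) (y : EuclideanSpace ℝ (Fin d)) :
    Integrable (fun x => u x * gaussian s y x) (mu d α) :=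
  hu.integrable_mul (memLp_gaussian hα hs y)

theorem topologicalClosure_span_gaussianLp (hα : -1 / 2 < α) :
    (Submodule.span ℂ (range (gaussianLp (d := d) hα))).topologicalClosure = ⊤ := by
  rw [Submodule.topologicalClosure_eq_top_iff, Submodule.eq_bot_iff]
  intro u hu
  rw [Submodule.mem_orthogonal] at hu
  refine (Lp.eq_zero_iff_ae_eq_zero).2 ?_
  refine ae_eq_zero_of_integral_mul_gaussian
    (integrable_mul_gaussian hα (Lp.memLp u) one_pos 0) fun s hs y => ?_
  have := hu _ (Submodule.subset_span ⟨(⟨s, hs⟩, -y), rfl⟩)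
  rwa [inner_gaussianLp, neg_neg] at this

theorem transform_congr {f g : Pt d → ℂ} (h : f =ᵐ[mu d α] g) :
    transform α f = transform α g := by
  ext l
  refine integral_congr_ae ?_
  filter_upwards [h] with x hx
  rw [hx]

theorem transform_linearCombination (hα : -1 / 2 < α) (l : GaussianIndex d →₀ ℂ) :
    Integrable (Finsupp.linearCombination ℂ (gaussianLp hα) l) (mu d α) ∧
      transform α (Finsupp.linearCombination ℂ (gaussianLp hα) l) =ᵐ[mu d α]
        Finsupp.linearCombination ℂ (bumpLp hα) l := by
  induction l using Finsupp.induction_linear with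
  | zero =>
    rw [map_zero, map_zero]
    have h0 := Lp.coeFn_zero ℂ 2 (mu d α)
    refine ⟨(integrable_zero _ _ _).congr h0.symm, ?_⟩
    rw [transform_congr h0]
    refine EventuallyEq.trans (Eventually.of_forall fun l => ?_) h0.symm
    simp [transform]
  | add f g hf hg =>
    rw [map_add, map_add]
    have h1 := Lp.coeFn_add (Finsupp.linearCombination ℂ (gaussianLp hα) f)
      (Finsupp.linearCombination ℂ (gaussianLp hα) g)
    refine ⟨(hf.1.add hg.1).congr h1.symm, ?_⟩
    rw [transform_congr h1]
    filter_upwards [hf.2, hg.2, Lp.coeFn_add (Finsupp.linearCombination ℂ (bumpLp hα) f)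
      (Finsupp.linearCombination ℂ (bumpLp hα) g)] with x h2 h3 h4
    rw [h4, Pi.add_apply, ← h2, ← h3]
    simp only [transform, Pi.add_apply, add_mul]
    exact integral_add (integrable_mul_kernel hα hf.1 x) (integrable_mul_kernel hα hg.1 x)
  | single i c =>
    rw [Finsupp.linearCombination_single, Finsupp.linearCombination_single]
    have h1 : ⇑(c • gaussianLp hα i) =ᵐ[mu d α] c • gaussian i.1 i.2 :=
      (Lp.coeFn_smul _ _).trans ((memLp_gaussian hα i.1.2 i.2).coeFn_toLp.const_smul c)
    have h2 : ⇑(c • bumpLp hα i) =ᵐ[mu d α] c • bump α i.1 i.2 :=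
      (Lp.coeFn_smul _ _).trans ((memLp_bump hα i.1.2 i.2).coeFn_toLp.const_smul c)
    refine ⟨((integrable_gaussian hα i.1.2 i.2).smul c).congr h1.symm, ?_⟩
    rw [transform_congr h1]
    refine EventuallyEq.trans (Eventually.of_forall fun l => ?_) h2.symm
    rw [Pi.smul_apply, ← transform_gaussian hα i.1.2]
    simp only [transform, Pi.smul_apply, smul_mul_assoc]
    exact integral_smul _ _

/-- Approximate `u` by combinations of Gaussians. The same combinations of the transforms have the
same mutual distances, so they are Cauchy and their limit has the norm of `u`. -/
theorem exists_tendsto_transform (hα : -1 / 2 < α) (u : Lp ℂ 2 (mu d α)) :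
    ∃ (k : Lp ℂ 2 (mu d α)) (f g : ℕ → Lp ℂ 2 (mu d α)),
      (∀ n, Integrable (f n) (mu d α) ∧ transform α (f n) =ᵐ[mu d α] g n) ∧
      Tendsto f atTop (𝓝 u) ∧ Tendsto g atTop (𝓝 k) ∧ ‖k‖ = ‖u‖ := by
  have hu : u ∈ closure (Submodule.span ℂ (range (gaussianLp (d := d) hα)) : Set _) := by
    rw [← Submodule.topologicalClosure_coe, topologicalClosure_span_gaussianLp]
    trivial
  obtain ⟨f, hf, hfu⟩ := mem_closure_iff_seq_limit.1 hu
  choose l hl using fun n => (Finsupp.mem_span_range_iff_exists_finsupp).1 (hf n)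
  have hl' (n : ℕ) : Finsupp.linearCombination ℂ (gaussianLp hα) (l n) = f n := hl n
  have hnorm := norm_linearCombination_eq (inner_bumpLp_bumpLp (d := d) hα)
  have hcauchy : CauchySeq fun n => Finsupp.linearCombination ℂ (bumpLp hα) (l n) := by
    rw [cauchySeq_iff]
    have hc := cauchySeq_iff.1 hfu.cauchySeq
    intro V hV
    obtain ⟨ε, hε, hεV⟩ := Metric.mem_uniformity_dist.1 hV
    obtain ⟨N, hN⟩ := hc _ (Metric.dist_mem_uniformity hε)
    refine ⟨N, fun m hm n hn => hεV ?_⟩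
    have h1 : dist (f m) (f n) < ε := hN m hm n hn
    rwa [dist_eq_norm, ← map_sub, hnorm, map_sub, hl', hl', ← dist_eq_norm]
  obtain ⟨k, hk⟩ := cauchySeq_tendsto_of_complete hcauchy
  refine ⟨k, f, _, fun n => ?_, hfu, hk, ?_⟩
  · rw [← hl' n]
    exact transform_linearCombination hα (l n)
  · refine tendsto_nhds_unique hk.norm ?_
    simp_rw [hnorm, hl']
    exact hfu.norm

/-- Plancherel's theorem for the Weinstein transform. -/
theorem eLpNorm_transform (hα : -1 / 2 < α) {f : Pt d → ℂ} (hf : MemLp f 1 (mu d α))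
    (hf' : MemLp f 2 (mu d α)) :
    eLpNorm (transform α f) 2 (mu d α) = eLpNorm f 2 (mu d α) := by
  have hfi := memLp_one_iff_integrable.1 hf
  obtain ⟨k, u, v, huv, hu, hv, hk⟩ := exists_tendsto_transform hα (hf'.toLp f)
  -- The multiplication formula passes to the limit along the approximating sequence.
  have hlim (i : GaussianIndex d) :
      inner ℂ (gaussianLp hα (i.1, -i.2)) k = inner ℂ (bumpLp hα i) (hf'.toLp f) := by
    refine tendsto_nhds_unique (tendsto_const_nhds.inner hv) ?_
    have h1 (n : ℕ) : inner ℂ (gaussianLp hα (i.1, -i.2)) (v n) =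
        inner ℂ (bumpLp hα i) (u n) := by
      rw [inner_gaussianLp, inner_bumpLp, ← transform_gaussian hα i.1.2,
        ← integral_transform_mul hα (huv n).1 (integrable_gaussian hα i.1.2 _)]
      refine integral_congr_ae ?_
      filter_upwards [(huv n).2] with x hx
      rw [hx, neg_neg]
    simp_rw [h1]
    exact tendsto_const_nhds.inner hu
  have hmeas := stronglyMeasurable_transform hα hfi.1
  have hti (s : ℝ) (hs : 0 < s) (y) :
      Integrable (fun x => transform α f x * gaussian s y x) (mu d α) := by
    refine (integrable_gaussian hα hs y).bdd_mul (c := (eLpNorm f 1 (mu d α)).toReal)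
      hmeas.aestronglyMeasurable (Eventually.of_forall fun x => ?_)
    rw [← toReal_enorm]
    exact ENNReal.toReal_mono hf.2.ne (norm_transform_le hα f x)
  -- Membership of `transform α f` in `L²` is not yet known, but it is bounded, hence integrable
  -- against every Gaussian, and there it has the same integrals as `k`.
  have hae : (fun x => transform α f x - k x) =ᵐ[mu d α] 0 := by
    refine ae_eq_zero_of_integral_mul_gaussian ?_ fun s hs y => ?_
    · simp only [sub_mul]
      exact (hti 1 one_pos 0).sub (integrable_mul_gaussian hα (Lp.memLp k) one_pos 0)
    · simp only [sub_mul]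
      rw [integral_sub (hti s hs y) (integrable_mul_gaussian hα (Lp.memLp k) hs y),
        integral_transform_mul hα hfi (integrable_gaussian hα hs y), transform_gaussian hα hs,
        sub_eq_zero]
      have h2 := hlim (⟨s, hs⟩, y)
      rw [inner_gaussianLp, inner_bumpLp, neg_neg] at h2
      refine Eq.trans ?_ h2.symm
      refine integral_congr_ae ?_
      filter_upwards [hf'.coeFn_toLp] with x hx
      rw [hx]
  have hae' : transform α f =ᵐ[mu d α] k := by
    filter_upwards [hae] with x hx
    exact sub_eq_zero.1 hx
  rw [eLpNorm_congr_ae hae', ← Lp.enorm_def, ← ofReal_norm, hk, ofReal_norm,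
    Lp.enorm_toLp]

theorem memLp_transform (hα : -1 / 2 < α) {f : Pt d → ℂ} (hf : MemLp f 1 (mu d α))
    (hf' : MemLp f 2 (mu d α)) : MemLp (transform α f) 2 (mu d α) :=
  ⟨(stronglyMeasurable_transform hα hf.1).aestronglyMeasurable, by
    rw [eLpNorm_transform hα hf hf']
    exact hf'.2⟩

theorem exists_isTransformL2 (hα : -1 / 2 < α) {φ : Pt d → ℂ} (hφ : MemLp φ 2 (mu d α)) :
    ∃ g, IsTransformL2 α φ g := by
  obtain ⟨k, f, g, hfg, hf, hg, -⟩ := exists_tendsto_transform hα (hφ.toLp φ)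
  refine ⟨k, Lp.memLp k, fun n => f n,
    fun n => ⟨memLp_one_iff_integrable.2 (hfg n).1, Lp.memLp _⟩, ?_, ?_⟩
  · refine ((Lp.tendsto_Lp_iff_tendsto_eLpNorm' _ _).1 hf).congr fun n => eLpNorm_congr_ae ?_
    exact (EventuallyEq.refl _ _).sub hφ.coeFn_toLp
  · refine ((Lp.tendsto_Lp_iff_tendsto_eLpNorm' _ _).1 hg).congr fun n => eLpNorm_congr_ae ?_
    exact (hfg n).2.symm.sub (EventuallyEq.refl _ _)

theorem isTransformL2_transformL2 (hα : -1 / 2 < α) {φ : Pt d → ℂ} (hφ : MemLp φ 2 (mu d α)) :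
    IsTransformL2 α φ (transformL2 α φ) := by
  have h := exists_isTransformL2 hα hφ
  rw [transformL2, dif_pos h]
  exact h.choose_spec

/-- Plancherel for the differences with an approximating sequence, in the limit. It holds for every
admissible `g`, so neither uniqueness nor linearity of the chosen extension is needed. -/
theorem IsTransformL2.eLpNorm_sub (hα : -1 / 2 < α) {φ g f : Pt d → ℂ} (h : IsTransformL2 α φ g)
    (hφ : MemLp φ 2 (mu d α)) (hf : MemLp f 1 (mu d α)) (hf' : MemLp f 2 (mu d α)) :
    eLpNorm (g - transform α f) 2 (mu d α) = eLpNorm (φ - f) 2 (mu d α) := by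
  obtain ⟨hg, u, hu, huφ, hug⟩ := h
  have h1 := tendsto_eLpNorm_sub_of_tendsto (fun n => (hu n).2) hφ hf' huφ
  have h2 := tendsto_eLpNorm_sub_of_tendsto (fun n => memLp_transform hα (hu n).1 (hu n).2) hg
    (memLp_transform hα hf hf') hug
  refine tendsto_nhds_unique h2 (h1.congr fun n => ?_)
  rw [← transform_sub hα (memLp_one_iff_integrable.1 (hu n).1) (memLp_one_iff_integrable.1 hf),
    eLpNorm_transform hα ((hu n).1.sub hf) ((hu n).2.sub hf')]

theorem IsTransformL2.eLpNorm_eq (hα : -1 / 2 < α) {φ g : Pt d → ℂ} (h : IsTransformL2 α φ g)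
    (hφ : MemLp φ 2 (mu d α)) : eLpNorm g 2 (mu d α) = eLpNorm φ 2 (mu d α) := by
  have h0 : transform α (0 : Pt d → ℂ) = 0 := by
    ext l
    simp [transform]
  simpa [h0] using h.eLpNorm_sub hα hφ (f := 0) MemLp.zero MemLp.zero

end Weinstein

/-! ### Dilations and the multiplier operators. -/

theorem MeasureTheory.eLpNorm_two_sq {X : Type*} [MeasurableSpace X] (ρ : Measure X) (f : X → ℂ) :
    eLpNorm f 2 ρ ^ 2 = ∫⁻ x, ‖f x‖ₑ ^ 2 ∂ρ := by
  have h := eLpNorm_nnreal_pow_eq_lintegral (μ := ρ) (f := f) (p := 2) two_ne_zero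
  simpa [ENNReal.rpow_ofNat] using h

namespace Weinstein

variable {d : ℕ} {α : ℝ}

/-- The density of the weighted measure. -/
def density (d : ℕ) (α : ℝ) (x : Pt d) : ℝ≥0∞ :=
  ENNReal.ofReal
    (x.2 ^ (2 * α + 1) / ((2 * Real.pi) ^ ((d : ℝ) / 2) * 2 ^ α * Real.Gamma (α + 1)))

theorem measurable_density (d : ℕ) (α : ℝ) : Measurable (density d α) := by
  unfold density
  fun_prop

theorem lintegral_mu (F : Pt d → ℝ≥0∞) (hF : Measurable F) :
    ∫⁻ x, F x ∂mu d α = ∫⁻ x, (halfSpace d).indicator (fun x => density d α x * F x) x := by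
  rw [lintegral_indicator (measurableSet_halfSpace d), mu]
  exact lintegral_withDensity_eq_lintegral_mul _ (measurable_density d α) hF

theorem density_smul {σ : ℝ} (hσ : 0 < σ) {x : Pt d} (hx : x ∈ halfSpace d) :
    density d α x = ENNReal.ofReal (σ ^ (-(2 * α + 1))) * density d α (σ • x) := by
  have hx' : (0 : ℝ) < x.2 := hx
  rw [density, density, ← ENNReal.ofReal_mul (by positivity), Prod.smul_snd, smul_eq_mul,
    Real.mul_rpow hσ.le hx'.le, Real.rpow_neg hσ.le]
  congr 1
  have : 0 < σ ^ (2 * α + 1) := by positivity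
  field_simp

/-- The weight is homogeneous of degree `2α + 1`, and Lebesgue measure contributes the dimension `d
+ 1`. -/
theorem map_smul_mu {σ : ℝ} (hσ : 0 < σ) :
    (mu d α).map (fun x => σ • x) = ENNReal.ofReal (σ ^ (-(2 * α + d + 2))) • mu d α := by
  refine Measure.ext_of_lintegral _ fun F hF => ?_
  have hm : Measurable fun x : Pt d => σ • x := measurable_const_smul σ
  rw [lintegral_map hF hm, lintegral_smul_measure, lintegral_mu (fun x => F (σ • x)) (hF.comp hm), lintegral_mu _ hF]
  have hind : Measurable ((halfSpace d).indicator fun x => density d α x * F x) :=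
    ((measurable_density d α).mul hF).indicator (measurableSet_halfSpace d)
  have h1 (x : Pt d) : (halfSpace d).indicator (fun x => density d α x * F (σ • x)) x =
      ENNReal.ofReal (σ ^ (-(2 * α + 1))) *
        (halfSpace d).indicator (fun x => density d α x * F x) (σ • x) := by
    by_cases hx : x ∈ halfSpace d
    · have hx' : σ • x ∈ halfSpace d := mul_pos hσ hx
      rw [indicator_of_mem hx, indicator_of_mem hx', density_smul hσ hx, mul_assoc]
    · have hx' : σ • x ∉ halfSpace d := fun h => hx ((mul_pos_iff_of_pos_left hσ).1 h)
      rw [indicator_of_notMem hx, indicator_of_notMem hx', mul_zero]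
  have : (volume : Measure (Pt d)).IsAddHaarMeasure := by
    rw [Measure.volume_eq_prod]
    infer_instance
  simp only [h1]
  rw [lintegral_const_mul' _ _ ENNReal.ofReal_ne_top, ← lintegral_map hind hm,
    Measure.map_addHaar_smul _ hσ.ne', lintegral_smul_measure, smul_eq_mul, smul_eq_mul,
    ← mul_assoc, ← ENNReal.ofReal_mul (by positivity)]
  congr 2
  rw [Module.finrank_prod, finrank_euclideanSpace_fin, Module.finrank_self, abs_of_pos (by positivity),
    ← Real.rpow_natCast, ← Real.rpow_neg hσ.le, ← Real.rpow_add hσ]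
  congr 1
  push_cast
  ring

theorem quasiMeasurePreserving_smul {σ : ℝ} (hσ : 0 < σ) :
    Measure.QuasiMeasurePreserving (fun x : Pt d => σ • x) (mu d α) (mu d α) :=
  ⟨measurable_const_smul σ, by
    rw [map_smul_mu hσ]
    exact Measure.smul_absolutelyContinuous⟩

theorem measurePreserving_reflect (d : ℕ) (α : ℝ) :
    MeasurePreserving (reflect (d := d)) (mu d α) (mu d α) := by
  rw [mu_eq_prod]
  exact MeasurePreserving.prod ((Measure.measurePreserving_neg volume).smul_measure _)
    (MeasurePreserving.id _)

instance : SFinite dilationMeasure := by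
  unfold dilationMeasure; infer_instance

theorem ae_dilationMeasure_pos : ∀ᵐ σ ∂dilationMeasure, 0 < σ :=
  (withDensity_absolutelyContinuous _ _).ae_le (ae_restrict_mem measurableSet_Ioi)

theorem ae_Theta_pos (d : ℕ) (α : ℝ) : ∀ᵐ p ∂Theta d α, 0 < p.1 :=
  Measure.quasiMeasurePreserving_fst.ae ae_dilationMeasure_pos

theorem memLp_comp_smul {m : Pt d → ℂ} {p : ℝ≥0∞} (hm : MemLp m p (mu d α)) {σ : ℝ}
    (hσ : 0 < σ) : MemLp (fun z => m (σ • z)) p (mu d α) := by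
  have h := hm.smul_measure (c := ENNReal.ofReal (σ ^ (-(2 * α + d + 2)))) ENNReal.ofReal_ne_top
  rw [← map_smul_mu hσ] at h
  exact (memLp_map_measure_iff h.1 (measurable_const_smul σ).aemeasurable).1 h

theorem eLpNorm_one_comp_smul {m : Pt d → ℂ} (hm : AEStronglyMeasurable m (mu d α)) {σ : ℝ}
    (hσ : 0 < σ) : eLpNorm (fun z => m (σ • z)) 1 (mu d α) =
      ENNReal.ofReal (σ ^ (-(2 * α + d + 2))) * eLpNorm m 1 (mu d α) := by
  have hm' : AEStronglyMeasurable m ((mu d α).map fun x => σ • x) := by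
    rw [map_smul_mu hσ]
    exact hm.smul_measure _
  have h := eLpNorm_map_measure (p := 1) hm' (measurable_const_smul σ).aemeasurable
  rw [Function.comp_def] at h
  rw [← h, map_smul_mu hσ, eLpNorm_one_smul_measure]

/-- The multiplier operator in terms of the transform `g` of the function it acts on. -/
def multiplierAux (α : ℝ) (m g : Pt d → ℂ) (p : ℝ × Pt d) : ℂ :=
  invTransform α (fun z => m (p.1 • z) * g z) p.2

theorem multiplier_eq (m φ : Pt d → ℂ) :
    multiplier α m φ = multiplierAux α m (transformL2 α φ) := rfl

/-- As `m` is measurable only up to null sets, the map `(σ, x) ↦ σ x` must pull null sets back to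
null sets; this is checked for each `σ > 0`. -/
theorem aestronglyMeasurable_dilate {m : Pt d → ℂ} (hm : AEStronglyMeasurable m (mu d α)) :
    AEStronglyMeasurable (fun p : ℝ × Pt d => m (p.1 • p.2)) (Theta d α) := by
  refine hm.comp_quasiMeasurePreserving
    (QuasiMeasurePreserving.prod_of_right (f := fun p : ℝ × Pt d => p.1 • p.2) (by fun_prop) ?_)
  filter_upwards [ae_dilationMeasure_pos] with σ hσ
  exact quasiMeasurePreserving_smul hσ

theorem aestronglyMeasurable_multiplierAux (hα : -1 / 2 < α) {m g : Pt d → ℂ}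
    (hm : AEStronglyMeasurable m (mu d α)) (hg : AEStronglyMeasurable g (mu d α)) :
    AEStronglyMeasurable (multiplierAux α m g) (Theta d α) := by
  have h1 : AEStronglyMeasurable (fun q : (ℝ × Pt d) × Pt d => m (q.1.1 • q.2))
      ((Theta d α).prod (mu d α)) := by
    refine hm.comp_quasiMeasurePreserving
      (QuasiMeasurePreserving.prod_of_right (f := fun q : (ℝ × Pt d) × Pt d => q.1.1 • q.2)
        (by fun_prop) ?_)
    filter_upwards [ae_Theta_pos d α] with p hp
    exact quasiMeasurePreserving_smul hp
  have h2 : Measurable fun q : (ℝ × Pt d) × Pt d => kernel α (reflect q.1.2) q.2 := by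
    have hr : Measurable fun q : (ℝ × Pt d) × Pt d => reflect q.1.2 := by
      unfold reflect
      fun_prop
    have hk := measurable_kernel (d := d) hα
    have hc : Measurable fun q : (ℝ × Pt d) × Pt d => (reflect q.1.2, q.2) :=
      hr.prodMk measurable_snd
    have h := hk.comp hc
    rwa [Function.comp_def] at h
  have h3 : AEStronglyMeasurable (fun q : (ℝ × Pt d) × Pt d => g q.2)
      ((Theta d α).prod (mu d α)) := hg.comp_snd
  have h4 := (h1.mul h3).mul h2.aestronglyMeasurable
  exact h4.integral_prod_right'

theorem lintegral_dilate_mul {m g : Pt d → ℂ} (hm : AEStronglyMeasurable m (mu d α))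
    (hadm : Admissible α m) (hg : AEStronglyMeasurable g (mu d α)) :
    ∫⁻ σ, ∫⁻ z, ‖m (σ • z) * g z‖ₑ ^ 2 ∂mu d α ∂dilationMeasure =
      ∫⁻ z, ‖g z‖ₑ ^ 2 ∂mu d α := by
  have hmeas : AEStronglyMeasurable (fun p : ℝ × Pt d => m (p.1 • p.2) * g p.2)
      (dilationMeasure.prod (mu d α)) := (aestronglyMeasurable_dilate hm).mul hg.comp_snd
  rw [lintegral_lintegral_swap (hmeas.enorm.pow_const 2)]
  refine lintegral_congr_ae ?_
  filter_upwards [hadm] with z hz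
  simp only [enorm_mul, mul_pow]
  rw [lintegral_mul_const' _ _ (by finiteness), hz, one_mul]

/-- Plancherel's theorem for the multiplier operators. -/
theorem eLpNorm_multiplierAux (hα : -1 / 2 < α) {m g : Pt d → ℂ}
    (hm : MemLp m 2 (mu d α)) (hadm : Admissible α m) (hg : MemLp g 2 (mu d α)) :
    eLpNorm (multiplierAux α m g) 2 (Theta d α) = eLpNorm g 2 (mu d α) := by
  suffices h : eLpNorm (multiplierAux α m g) 2 (Theta d α) ^ 2 = eLpNorm g 2 (mu d α) ^ 2 from
    le_antisymm ((ENNReal.pow_le_pow_left_iff two_ne_zero).1 h.le)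
      ((ENNReal.pow_le_pow_left_iff two_ne_zero).1 h.ge)
  have hmeas := aestronglyMeasurable_multiplierAux hα hm.1 hg.1
  rw [eLpNorm_two_sq, eLpNorm_two_sq, ← lintegral_dilate_mul hm.1 hadm hg.1, Theta,
    lintegral_prod _ (hmeas.enorm.pow_const 2)]
  have hmeas' : AEMeasurable (fun p : ℝ × Pt d => ‖m (p.1 • p.2) * g p.2‖ₑ ^ 2)
      (dilationMeasure.prod (mu d α)) :=
    ((aestronglyMeasurable_dilate hm.1).mul hg.1.comp_snd).enorm.pow_const 2
  -- A product of two `L²` functions is only known to be in `L¹`. Finiteness of the double integral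
  -- puts it in `L²` for almost every `σ`, where Plancherel applies.
  have hfin : ∀ᵐ σ ∂dilationMeasure, ∫⁻ z, ‖m (σ • z) * g z‖ₑ ^ 2 ∂mu d α < ⊤ := by
    refine ae_lt_top' hmeas'.lintegral_prod_right' ?_
    rw [lintegral_dilate_mul hm.1 hadm hg.1, ← eLpNorm_two_sq]
    exact ENNReal.pow_ne_top hg.2.ne
  refine lintegral_congr_ae ?_
  filter_upwards [hfin, ae_dilationMeasure_pos] with σ h1 hσ
  have hmσ := memLp_comp_smul hm hσ
  have hi1 : MemLp (fun z => m (σ • z) * g z) 1 (mu d α) :=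
    memLp_one_iff_integrable.2 (hmσ.integrable_mul hg)
  have hi2 : MemLp (fun z => m (σ • z) * g z) 2 (mu d α) := by
    refine ⟨hi1.1, ?_⟩
    rw [← eLpNorm_two_sq] at h1
    exact (ENNReal.pow_lt_top_iff.1 h1).resolve_right two_ne_zero
  rw [← eLpNorm_two_sq, ← eLpNorm_two_sq, ← eLpNorm_transform hα hi1 hi2,
    ← eLpNorm_comp_measurePreserving (memLp_transform hα hi1 hi2).1 (measurePreserving_reflect d α)]
  rfl

theorem multiplierAux_sub (hα : -1 / 2 < α) {m g h : Pt d → ℂ} (hm : MemLp m 2 (mu d α))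
    (hg : MemLp g 2 (mu d α)) (hh : MemLp h 2 (mu d α)) {p : ℝ × Pt d} (hp : 0 < p.1) :
    multiplierAux α m (g - h) p = multiplierAux α m g p - multiplierAux α m h p := by
  have hmσ := memLp_comp_smul hm hp
  have hi {f : Pt d → ℂ} (hf : MemLp f 2 (mu d α)) :
      Integrable (fun z => m (p.1 • z) * f z) (mu d α) := hmσ.integrable_mul hf
  have := transform_sub hα (hi hg) (hi hh)
  simp only [multiplierAux, invTransform]
  rw [← Pi.sub_apply, ← this]
  congr 1
  ext z
  exact mul_sub _ _ _

/-- The transform is bounded by the `L¹` norm, and dilating `m` scales that norm by a power of `σ`;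
this is the source of the weight in the theorem. -/
theorem enorm_multiplierAux_le (hα : -1 / 2 < α) {m g : Pt d → ℂ}
    (hm : AEStronglyMeasurable m (mu d α)) {C : ℝ≥0∞} (hg : ∀ z, ‖g z‖ₑ ≤ C) (hC : C ≠ ⊤)
    {p : ℝ × Pt d} (hp : 0 < p.1) :
    ‖multiplierAux α m g p‖ₑ ≤
      ENNReal.ofReal (p.1 ^ (-(2 * α + d + 2))) * (eLpNorm m 1 (mu d α) * C) := by
  refine (norm_transform_le hα _ _).trans ?_
  rw [← mul_assoc, ← eLpNorm_one_comp_smul hm hp, eLpNorm_one_eq_lintegral_enorm,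
    eLpNorm_one_eq_lintegral_enorm, ← lintegral_mul_const' _ _ hC]
  refine lintegral_mono fun z => ?_
  rw [enorm_mul]
  exact mul_le_mul_right (hg z) _

theorem eLpNorm_indicator_multiplierAux_le (hα : -1 / 2 < α) {m g : Pt d → ℂ}
    (hm : AEStronglyMeasurable m (mu d α)) {C : ℝ≥0∞} (hg : ∀ z, ‖g z‖ₑ ≤ C) (hC : C ≠ ⊤)
    {S : Set (ℝ × Pt d)} (hS : MeasurableSet S) :
    eLpNorm (S.indicator (multiplierAux α m g)) 2 (Theta d α) ≤
      eLpNorm m 1 (mu d α) * C *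
        (∫⁻ p in S, ENNReal.ofReal (1 / p.1 ^ (2 * (2 * α + d + 2))) ∂Theta d α) ^ (1 / 2 : ℝ) := by
  refine (ENNReal.pow_le_pow_left_iff two_ne_zero).1 ?_
  rw [eLpNorm_indicator_eq_eLpNorm_restrict hS, eLpNorm_two_sq, mul_pow,
    ← ENNReal.rpow_natCast (_ ^ (1 / 2 : ℝ)), ← ENNReal.rpow_mul]
  norm_num only [Nat.cast_ofNat]
  rw [ENNReal.rpow_one, ← lintegral_const_mul _ (by fun_prop)]
  refine lintegral_mono_ae ?_
  filter_upwards [ae_restrict_of_ae (ae_Theta_pos d α)] with p hp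
  refine (pow_le_pow_left₀ (zero_le) (enorm_multiplierAux_le hα hm hg hC hp) 2).trans ?_
  rw [mul_pow, mul_comm, ← ENNReal.ofReal_pow (by positivity)]
  refine mul_le_mul_right (ENNReal.ofReal_le_ofReal (le_of_eq ?_)) _
  rw [Real.rpow_neg hp.le, inv_pow, ← Real.rpow_mul_natCast hp.le, one_div, Nat.cast_ofNat, mul_comm]

/-! ### The uncertainty inequality. -/

theorem Concentrated.eLpNorm_sub_le {X : Type*} [MeasurableSpace X] {ρ : Measure X} {ε : ℝ}
    {S : Set X} {f : X → ℂ} (h : Concentrated ρ ε S f) (hS : MeasurableSet S)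
    (hf : MemLp f 2 ρ) (h0 : eLpNorm f 2 ρ ≠ 0) :
    0 ≤ ε ∧ eLpNorm (f - S.indicator f) 2 ρ ≤ ENNReal.ofReal ε * eLpNorm f 2 ρ := by
  have hpos : 0 < (eLpNorm f 2 ρ).toReal := ENNReal.toReal_pos h0 hf.2.ne
  have hε : 0 ≤ ε := nonneg_of_mul_nonneg_left (ENNReal.toReal_nonneg.trans h) hpos
  refine ⟨hε, ?_⟩
  rw [← ENNReal.ofReal_toReal (hf.sub (hf.indicator hS)).2.ne,
    ← ENNReal.ofReal_toReal (hf.2.ne), ← ENNReal.ofReal_mul hε]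
  exact ENNReal.ofReal_le_ofReal h

/-- Cauchy–Schwarz on `Ω`. -/
theorem eLpNorm_one_indicator_le {φ : Pt d → ℂ} (hφ : MemLp φ 2 (mu d α)) {Ω : Set (Pt d)}
    (hΩ : MeasurableSet Ω) :
    eLpNorm (Ω.indicator φ) 1 (mu d α) ≤ mu d α Ω ^ (1 / 2 : ℝ) * eLpNorm φ 2 (mu d α) := by
  rw [eLpNorm_indicator_eq_eLpNorm_restrict hΩ]
  refine (eLpNorm_le_eLpNorm_mul_rpow_measure_univ one_le_two hφ.1.restrict).trans ?_
  rw [Measure.restrict_apply_univ, mul_comm]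
  refine mul_le_mul' (le_of_eq ?_) (eLpNorm_mono_measure _ Measure.restrict_le_self)
  norm_num

theorem one_le_of_concentrated (hα : -1 / 2 < α) {m φ : Pt d → ℂ}
    (hm₁ : MemLp m 1 (mu d α)) (hm₂ : MemLp m 2 (mu d α)) (hadm : Admissible α m)
    (hφ : MemLp φ 2 (mu d α)) (hφ₀ : eLpNorm φ 2 (mu d α) ≠ 0)
    {Ω : Set (Pt d)} (hΩ : MeasurableSet Ω) (hΩfin : mu d α Ω ≠ ⊤)
    {S : Set (ℝ × Pt d)} (hS : MeasurableSet S) {e n : ℝ≥0∞}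
    (he : eLpNorm (φ - Ω.indicator φ) 2 (mu d α) ≤ e * eLpNorm φ 2 (mu d α))
    (hn : eLpNorm (multiplier α m φ - S.indicator (multiplier α m φ)) 2 (Theta d α) ≤
      n * eLpNorm φ 2 (mu d α)) :
    1 ≤ n + e + eLpNorm m 1 (mu d α) * mu d α Ω ^ (1 / 2 : ℝ) *
        (∫⁻ p in S, ENNReal.ofReal (1 / p.1 ^ (2 * (2 * α + d + 2))) ∂Theta d α)
          ^ (1 / 2 : ℝ) := by
  have hA := isTransformL2_transformL2 hα hφ
  have hψ₂ : MemLp (Ω.indicator φ) 2 (mu d α) := hφ.indicator hΩ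
  have hbound := eLpNorm_one_indicator_le hφ hΩ
  have hC : mu d α Ω ^ (1 / 2 : ℝ) * eLpNorm φ 2 (mu d α) ≠ ⊤ :=
    ENNReal.mul_ne_top (ENNReal.rpow_ne_top_of_nonneg (by norm_num) hΩfin) hφ.2.ne
  have hψ₁ : MemLp (Ω.indicator φ) 1 (mu d α) := ⟨hψ₂.1, hbound.trans_lt hC.lt_top⟩
  have hB := memLp_transform hα hψ₁ hψ₂
  set A := transformL2 α φ
  set B := transform α (Ω.indicator φ)
  have hTA := aestronglyMeasurable_multiplierAux hα hm₂.1 hA.1.1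
  have hTB := aestronglyMeasurable_multiplierAux hα hm₂.1 hB.1
  have h1 : eLpNorm (multiplierAux α m A) 2 (Theta d α) = eLpNorm φ 2 (mu d α) := by
    rw [eLpNorm_multiplierAux hα hm₂ hadm hA.1, hA.eLpNorm_eq hα hφ]
  have h2 : eLpNorm (S.indicator (multiplierAux α m A - multiplierAux α m B)) 2 (Theta d α) ≤
      e * eLpNorm φ 2 (mu d α) := by
    refine (eLpNorm_indicator_le _).trans ?_
    have : multiplierAux α m A - multiplierAux α m B =ᵐ[Theta d α] multiplierAux α m (A - B) := by
      filter_upwards [ae_Theta_pos d α] with p hp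
      exact (multiplierAux_sub hα hm₂ hA.1 hB hp).symm
    rw [eLpNorm_congr_ae this, eLpNorm_multiplierAux hα hm₂ hadm (hA.1.sub hB),
      hA.eLpNorm_sub hα hφ hψ₁ hψ₂]
    exact he
  have h3 := eLpNorm_indicator_multiplierAux_le hα hm₁.1
    (fun z => (norm_transform_le hα (Ω.indicator φ) z).trans hbound) hC hS
  -- Three errors: leaving `S`, replacing `φ` by its restriction to `Ω`, and the main term
  -- controlled pointwise.
  have h4 : multiplierAux α m A = (multiplierAux α m A - S.indicator (multiplierAux α m A)) +
      (S.indicator (multiplierAux α m A - multiplierAux α m B) +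
        S.indicator (multiplierAux α m B)) := by
    rw [indicator_sub', sub_add_cancel, sub_add_cancel]
  have h5 : eLpNorm φ 2 (mu d α) ≤ n * eLpNorm φ 2 (mu d α) + (e * eLpNorm φ 2 (mu d α) +
      eLpNorm m 1 (mu d α) * (mu d α Ω ^ (1 / 2 : ℝ) * eLpNorm φ 2 (mu d α)) *
        (∫⁻ p in S, ENNReal.ofReal (1 / p.1 ^ (2 * (2 * α + d + 2))) ∂Theta d α)
          ^ (1 / 2 : ℝ)) := by
    conv_lhs => rw [← h1, h4]
    refine (eLpNorm_add_le (hTA.sub (hTA.indicator hS))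
      (((hTA.sub hTB).indicator hS).add (hTB.indicator hS)) one_le_two).trans ?_
    refine add_le_add hn ((eLpNorm_add_le ((hTA.sub hTB).indicator hS)
      (hTB.indicator hS) one_le_two).trans (add_le_add h2 h3))
  refine (ENNReal.mul_le_mul_iff_left hφ₀ hφ.2.ne).1 ?_
  rw [one_mul]
  refine h5.trans (le_of_eq ?_)
  ring

end Weinstein

end

theorem theorem4p3 (d : ℕ) (α : ℝ) (hα : -1 / 2 < α)
    (m φ : Weinstein.Pt d → ℂ)
    (hm₁ : MemLp m 1 (Weinstein.mu d α)) (hm₂ : MemLp m 2 (Weinstein.mu d α))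
    (hadm : Weinstein.Admissible α m)
    (hφ : MemLp φ 2 (Weinstein.mu d α)) (hφ₀ : ¬ φ =ᵐ[Weinstein.mu d α] 0)
    (Ω : Set (Weinstein.Pt d)) (hΩ : MeasurableSet Ω) (hΩ' : Ω ⊆ Weinstein.halfSpace d)
    (S : Set (ℝ × Weinstein.Pt d)) (hS : MeasurableSet S)
    (hS' : S ⊆ Ioi (0 : ℝ) ×ˢ Weinstein.halfSpace d)
    (ε ν : ℝ)
    (hε : Weinstein.Concentrated (Weinstein.mu d α) ε Ω φ)
    (hν : Weinstein.Concentrated (Weinstein.Theta d α) ν S (Weinstein.multiplier α m φ)) :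
    ENNReal.ofReal (1 - (ε + ν)) ≤
      eLpNorm m 1 (Weinstein.mu d α) * Weinstein.mu d α Ω ^ (1 / 2 : ℝ) *
        (∫⁻ p in S, ENNReal.ofReal (1 / p.1 ^ (2 * (2 * α + d + 2))) ∂(Weinstein.Theta d α))
          ^ (1 / 2 : ℝ) := by
  open Weinstein in
  have hN : eLpNorm φ 2 (mu d α) ≠ 0 := fun h =>
    hφ₀ ((eLpNorm_eq_zero_iff hφ.1 two_ne_zero).1 h)
  have hA := isTransformL2_transformL2 hα hφ
  have hT : eLpNorm (multiplier α m φ) 2 (Theta d α) = eLpNorm φ 2 (mu d α) := by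
    rw [multiplier_eq, eLpNorm_multiplierAux hα hm₂ hadm hA.1, hA.eLpNorm_eq hα hφ]
  have hTm : MemLp (multiplier α m φ) 2 (Theta d α) :=
    ⟨aestronglyMeasurable_multiplierAux hα hm₂.1 hA.1.1, hT ▸ hφ.2⟩
  obtain ⟨hε0, he⟩ := hε.eLpNorm_sub_le hΩ hφ hN
  obtain ⟨hν0, hn⟩ := hν.eLpNorm_sub_le hS hTm (hT ▸ hN)
  rw [hT] at hn
  have key : ENNReal.ofReal (1 - (ε + ν)) ≤ 1 - (ENNReal.ofReal ν + ENNReal.ofReal ε) := by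
    rw [ENNReal.ofReal_sub _ (add_nonneg hε0 hν0), ENNReal.ofReal_one, add_comm ε,
      ENNReal.ofReal_add hν0 hε0]
  by_cases hΩfin : mu d α Ω = ⊤
  -- If `m` vanished almost everywhere, so would the multiplier image of `φ`, whose norm is that of
  -- `φ`. Hence `0 · ∞` cannot arise from `m`.
  · have hm0 : eLpNorm m 1 (mu d α) ≠ 0 := fun h => by
      refine hN ?_
      rw [← hT, eLpNorm_eq_zero_iff hTm.1 two_ne_zero]
      filter_upwards [ae_Theta_pos d α] with p hp
      have h1 := (norm_transform_le hα
        (fun z => m (p.1 • z) * transformL2 α φ z) (reflect p.2))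
      have h2 : (fun z => m (p.1 • z) * transformL2 α φ z) =ᵐ[mu d α] 0 := by
        have h3 := (eLpNorm_eq_zero_iff hm₁.1 one_ne_zero).1 h
        filter_upwards [(quasiMeasurePreserving_smul hp).ae h3] with z hz
        rw [hz, Pi.zero_apply, zero_mul, Pi.zero_apply]
      rw [eLpNorm_congr_ae h2, eLpNorm_zero, nonpos_iff_eq_zero, enorm_eq_zero] at h1
      exact h1
    by_cases hc : (∫⁻ p in S, ENNReal.ofReal (1 / p.1 ^ (2 * (2 * α + d + 2))) ∂(Theta d α)) = 0
    -- The weight is positive, so a zero integral makes `S` null. Concentration on a null set forces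
    -- `ν ≥ 1`, and the left-hand side is then zero.
    · have hS0 : S.indicator (multiplier α m φ) =ᵐ[Theta d α] 0 := by
        rw [lintegral_eq_zero_iff (by fun_prop)] at hc
        have h1 := (ae_restrict_iff' hS).1 hc
        filter_upwards [h1, ae_Theta_pos d α] with p hp hp0
        by_cases hpS : p ∈ S
        · have h2 := hp hpS
          rw [Pi.zero_apply, ENNReal.ofReal_eq_zero] at h2
          exact absurd h2 (not_le.2 (by positivity))
        · rw [indicator_of_notMem hpS, Pi.zero_apply]
      have h1 : multiplier α m φ - S.indicator (multiplier α m φ) =ᵐ[Theta d α]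
          multiplier α m φ := by
        filter_upwards [hS0] with p hp
        rw [Pi.sub_apply, hp, Pi.zero_apply, sub_zero]
      rw [eLpNorm_congr_ae h1, hT] at hn
      have h2 : 1 ≤ ENNReal.ofReal ν := by
        refine (ENNReal.mul_le_mul_iff_left hN hφ.2.ne).1 ?_
        rwa [one_mul]
      refine key.trans ?_
      rw [tsub_eq_zero_of_le (h2.trans le_self_add)]
      exact zero_le
    · rw [hΩfin, ENNReal.top_rpow_of_pos (by norm_num), ENNReal.mul_top hm0, ENNReal.top_mul]
      · exact le_top
      · rwa [Ne, ENNReal.rpow_eq_zero_iff_of_pos (by norm_num)]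
  · refine key.trans (tsub_le_iff_left.2 ?_)
    exact one_le_of_concentrated hα hm₁ hm₂ hadm hφ hN hΩ hΩfin hS he hn
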